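/- Let $a>0$, $\sigma>0$, $\alpha,\beta\in\mathbb R$, $b>4a$, $M\ge 1$, and let $$0<\tau<\min\Big\{\frac{a}{1+4b|\beta|},\ \frac{1}{1+12|\beta|},\ \frac{1}{1+4|\alpha|},\ \frac4a\Big\}.$$ Put $A=\begin{bmatrix}\alpha&-\beta\\ \beta&\alpha\end{bmatrix}$, $B=\begin{bmatrix}-a&-b\\ b&-a\end{bmatrix}$ and $F(X)=AX+\|X\|^2BX$ for $X\in\mathbb R^2$. Let $W$ be a planar Brownian motion and $\Delta W_{k+1}=W_{(k+1)\tau}-W_{k\tau}$. Consider the backward Euler method and its linearization $$X^\tau_{k+1}=X^\tau_k+\tau F(X^\tau_{k+1})+\sigma\,\Delta W_{k+1},$$ $$U^\tau_{k+1}=U^\tau_k+\tau\Big(AU^\tau_{k+1}+\|X^\tau_{k+1}\|^2BU^\tau_{k+1}+2\,(X^\tau_{k+1}\cdot U^\tau_{k+1})\,BX^\tau_{k+1}\Big),\qquad U^\tau_0\neq0,$$ and let $\xi^\tau_k\in\mathbb R/\pi\mathbb Z$ be the direction of $U^\tau_k$, that is $U^\tau_k=\pm\|U^\tau_k\|(\cos\xi^\tau_k,\sin\xi^\tau_k)^\top$.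 Both implicit equations are uniquely solvable (for $X^\tau_{k+1}$ and for $U^\tau_{k+1}$), so that $(X^\tau_k,\xi^\tau_k)_{k\ge0}$ is a Markov chain on $\mathbb R^2\times\mathbb R/\pi\mathbb Z$ and $(X^\tau_k)_{k\ge0}$ is a Markov chain on $\mathbb R^2$. Define, for $X=(x,y)$, $$\hat Q(x,y,\xi)=\alpha-2a(x^2+y^2)-(2b\cos2\xi+2a\sin2\xi)\,xy+(b\sin2\xi-a\cos2\xi)(x^2-y^2),$$ $$\bar\Gamma(X,\xi)=\|X\|^2+|\xi|^2+M,$$ where $|\xi|$ is the least absolute value of a representative of $\xi\in\mathbb R/\pi\mathbb Z$. Then $(X^\tau_k,\xi^\tau_k)_{k\ge0}$ has a unique stationary probability measure $\nu^\tau$, and $(X^\tau_k)_{k\ge0}$ has a unique stationary probability measure $\tilde\nu^\tau$. Moreover $\hat Q$ is $\nu^\tau$-integrable, and there exist $\bar\iota\in(0,1)$ and $\bar\kappa\in(0,\infty)$ such that, for all deterministic initial states $(X^\tau_0,\xi^\tau_0)$ and all $k\ge0$, $\hat Q(X^\tau_k,\xi^\tau_k)$ is integrable and $$\left|\mathbb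 E^{X^\tau_0,\xi^\tau_0}\big[\hat Q(X^\tau_k,\xi^\tau_k)\big]-\nu^\tau(\hat Q)\right|\le\bar\kappa\,\bar\iota^{\,k\tau}\,\bar\Gamma(X^\tau_0,\xi^\tau_0),$$ where $\nu^\tau(\hat Q)=\int\hat Q\,d\nu^\tau$. -/

import Mathlib

open MeasureTheory ProbabilityTheory Matrix
open scoped NNReal

namespace HopfBEM

/-- The Euclidean plane. -/
abbrev E2 : Type := EuclideanSpace ℝ (Fin 2)

/-- The projective line of directions, `ℝ / πℤ`. -/
abbrev Direction : Type := AddCircle Real.pi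

/-- The linear part `[[α, -β], [β, α]]` of the drift. -/
def linPart (α β : ℝ) : Matrix (Fin 2) (Fin 2) ℝ := !![α, -β; β, α]

/-- The matrix `[[-a, -b], [b, -a]]` of the cubic part of the drift. -/
def cubPart (a b : ℝ) : Matrix (Fin 2) (Fin 2) ℝ := !![-a, -b; b, -a]

/-- The drift `F(X) = [[α, -β], [β, α]] X + ‖X‖² [[-a, -b], [b, -a]] X`. -/
noncomputable def drift (a b α β : ℝ) (X : E2) : E2 :=
  (linPart α β).toEuclideanLin X + ‖X‖ ^ 2 • (cubPart a b).toEuclideanLin X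

/-- The right-hand side of the variational equation at `X`, applied to `U`:
`[[α, -β], [β, α]] U + ‖X‖² [[-a, -b], [b, -a]] U + 2 (X · U) [[-a, -b], [b, -a]] X`. -/
noncomputable def varDrift (a b α β : ℝ) (X U : E2) : E2 :=
  (linPart α β).toEuclideanLin U + ‖X‖ ^ 2 • (cubPart a b).toEuclideanLin U
    + (2 * inner ℝ X U) • (cubPart a b).toEuclideanLin X

/-- The matrix `M(X)` of the linear map `U ↦ U - τ • varDrift X U`
(see `implicitMatrix_apply`). -/
noncomputable def implicitMatrix (a b α β τ : ℝ) (X : E2) : Matrix (Fin 2) (Fin 2) ℝ :=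
  1 - τ • (linPart α β + ‖X‖ ^ 2 • cubPart a b
    + Matrix.of fun i j => 2 * (cubPart a b *ᵥ X.ofLp) i * X j)

theorem implicitMatrix_apply (a b α β τ : ℝ) (X U : E2) :
    (implicitMatrix a b α β τ X).toEuclideanLin U = U - τ • varDrift a b α β X U := by
  ext i
  fin_cases i <;>
  · simp [implicitMatrix, vecHead, vecTail, varDrift, linPart, cubPart, Matrix.mulVec,
      dotProduct, Fin.sum_univ_two, inner]
    ring

/-- The unit vector `(cos t, sin t)`. -/
noncomputable def unitVec (t : ℝ) : E2 := !₂[Real.cos t, Real.sin t]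

/-- The direction `ξ ∈ ℝ / πℤ` of a nonzero vector `v`, that is the class of the angles `t` with
`v = ± ‖v‖ (cos t, sin t)`. -/
noncomputable def lineAngle (v : E2) : Direction :=
  ((Complex.arg ⟨v 0, v 1⟩ : ℝ) : Direction)

theorem lineAngle_neg (v : E2) : lineAngle (-v) = lineAngle v := by
  by_cases hv : (⟨v 0, v 1⟩ : ℂ) = 0
  · have h0 : v 0 = 0 := congrArg Complex.re hv
    have h1 : v 1 = 0 := congrArg Complex.im hv
    simp [lineAngle, h0, h1]
  · have h := Complex.arg_neg_coe_angle hv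
    rw [← Real.Angle.coe_add, Real.Angle.angle_eq_iff_two_pi_dvd_sub] at h
    obtain ⟨n, hn⟩ := h
    have hneg : (⟨(-v) 0, (-v) 1⟩ : ℂ) = -⟨v 0, v 1⟩ := by
      apply Complex.ext <;> simp
    unfold lineAngle
    rw [hneg, ← sub_eq_zero, ← AddCircle.coe_sub, AddCircle.coe_eq_zero_iff]
    refine ⟨2 * n + 1, ?_⟩
    push_cast [zsmul_eq_mul]
    linarith

theorem periodic_lineAngle (A : Matrix (Fin 2) (Fin 2) ℝ) :
    Function.Periodic (fun t : ℝ => lineAngle (A.toEuclideanLin (unitVec t))) Real.pi := by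
  intro t
  have h : unitVec (t + Real.pi) = -unitVec t := by
    ext i
    fin_cases i <;> simp [unitVec]
  simp only [h, map_neg, lineAngle_neg]

/-- The action of an invertible matrix on directions. -/
noncomputable def directionMap (A : Matrix (Fin 2) (Fin 2) ℝ) : Direction → Direction :=
  (periodic_lineAngle A).lift

/-- One step of the backward Euler method with noise increment `w`: the solution `Y` of
`Y = X + τ F(Y) + σ w`. -/
noncomputable def bemStep (a b α β σ τ : ℝ) (X w : E2) : E2 :=
  Function.invFun (fun Y : E2 => Y - τ • drift a b α β Y) (X + σ • w)

/-- One step of the pair (backward Euler method, direction of its linearization). The direction is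
moved by `U ↦ M(Y)⁻¹ U`, where `Y` is the new position. -/
noncomputable def pairStep (a b α β σ τ : ℝ) (z : E2 × Direction) (w : E2) : E2 × Direction :=
  (bemStep a b α β σ τ z.1 w,
    directionMap (implicitMatrix a b α β τ (bemStep a b α β σ τ z.1 w))⁻¹ z.2)

/-- The law `N(0, τ I₂)` of a planar Brownian increment over a time `τ`. -/
noncomputable def noiseLaw (τ : ℝ) : Measure E2 :=
  (Measure.pi fun _ : Fin 2 => gaussianReal 0 τ.toNNReal).map (WithLp.toLp 2)

/-- `ν` is a stationary (probability) measure of the Markov chain `z ↦ step z w`, with independent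
noise `w` of law `γ`: if `z` has law `ν` and is independent of `w`, then `step z w` has law `ν`. -/
def IsStationary {S : Type*} [MeasurableSpace S] (step : S → E2 → S) (γ : Measure E2)
    (ν : Measure S) : Prop :=
  IsProbabilityMeasure ν ∧ (ν.prod γ).map (fun p : S × E2 => step p.1 p.2) = ν

/-- A planar Brownian motion: two independent standard real Brownian motions. -/
def IsPlanarBrownian {Ω : Type*} [MeasurableSpace Ω] (W : Fin 2 → ℝ≥0 → Ω → ℝ)
    (P : Measure Ω) : Prop :=
  (∀ i, IsBrownianReal (W i) P) ∧ iIndepFun (fun i ω t => W i t ω) P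

/-- The increment `ΔW_{k+1} = W_{(k+1)τ} - W_{kτ}`. -/
noncomputable def increment {Ω : Type*} (W : Fin 2 → ℝ≥0 → Ω → ℝ) (τ : ℝ) (k : ℕ) (ω : Ω) : E2 :=
  WithLp.toLp 2 fun i =>
    W i (((k : ℝ) + 1) * τ).toNNReal ω - W i ((k : ℝ) * τ).toNNReal ω

/-- `X` is the backward Euler method driven by `W` started at `x₀`, and `U` its linearization
started at `u₀`; the equations hold almost surely. -/
def IsBEMSolution {Ω : Type*} [MeasurableSpace Ω] (a b α β σ τ : ℝ) (W : Fin 2 → ℝ≥0 → Ω → ℝ)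
    (P : Measure Ω) (x₀ u₀ : E2) (X U : ℕ → Ω → E2) : Prop :=
  ∀ᵐ ω ∂P, X 0 ω = x₀ ∧ U 0 ω = u₀ ∧ ∀ k : ℕ,
    X (k + 1) ω = X k ω + τ • drift a b α β (X (k + 1) ω) + σ • increment W τ k ω ∧
    U (k + 1) ω = U k ω + τ • varDrift a b α β (X (k + 1) ω) (U (k + 1) ω)

/-- `Q̂(x, y, t)` for a real angle `t`. -/
noncomputable def qHatReal (a b α x y t : ℝ) : ℝ :=
  α - 2 * a * (x ^ 2 + y ^ 2)
    - (2 * b * Real.cos (2 * t) + 2 * a * Real.sin (2 * t)) * (x * y)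
    + (b * Real.sin (2 * t) - a * Real.cos (2 * t)) * (x ^ 2 - y ^ 2)

theorem periodic_qHatReal (a b α x y : ℝ) :
    Function.Periodic (qHatReal a b α x y) Real.pi := by
  intro t
  simp only [qHatReal, mul_add, Real.cos_add_two_pi, Real.sin_add_two_pi]

/-- The function `Q̂` on `ℝ² × ℝ/πℤ`. -/
noncomputable def qHat (a b α : ℝ) (z : E2 × Direction) : ℝ :=
  (periodic_qHatReal a b α (z.1 0) (z.1 1)).lift z.2

/-- The Lyapunov function `‖X‖² + ξ² + M`. The norm of `ξ` in `ℝ/πℤ` is its distance to `0`, the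
least absolute value of a representative. -/
noncomputable def gammaBar (M : ℝ) (X : E2) (ξ : Direction) : ℝ :=
  ‖X‖ ^ 2 + ‖ξ‖ ^ 2 + M

end HopfBEM

open HopfBEM

/-! The theorem is an instance of Harris' ergodic theorem with Lyapunov function `V (X, ξ) = ‖X‖ ^
2`. Once drift and minorization are known for the pair chain, `exists_invariant_geometric` gives an
invariant law and geometric convergence for every observable of size `O(1 + V)`. The observable
`qHat` is of this size by `abs_qHat_le`. Projecting to the first coordinate transfers existence and
uniqueness to the position chain.

Drift comes from the cubic damping. With the plane identified with `ℂ`, the backward Euler map is `Y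
↦ m(|Y|²) Y` for a complex multiplier `m`. Hence everything about its inverse, the resolvent,
reduces to the strictly increasing real function `radial`. Its cubic growth yields
`norm_sq_resolvent_le`, and from it the drift factor 1/2 in `hasDrift_pairKernel`.

Minorization is the delicate point, since the direction receives no noise of its own. The implicit
matrix acts as `U ↦ P U + Q Ū` with `|Q| < |P|`, so its inverse turns the direction `t` by `arg P̄ +
arg (1 + k exp (-2it))` with `k = -Q / P̄`. By rotational symmetry, rotating the position by `φ` has
the same effect as replacing `t` by `t - φ` in this turn (`turnAngle_mul`). As the noise moves the
position around an annulus, the turn sweeps an interval of positive length. The turn is Lipschitz in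
the angle, so its law dominates a multiple of Lebesgue measure on that interval, and the interval
does not depend on `t` (`exists_mul_setLIntegral_le_polar`). Repeated steps convolve these intervals
until they cover the circle `ℝ / πℤ`. One further step spreads the position over a square, by
positivity of the Gaussian density. All bounds are uniform over bounded starting positions
(`exists_minorization_pairKernel`).

Finally, `IsBEMSolution.hasLaw` identifies the law of the solution with the iterated kernel:
Brownian increments are fresh Gaussian noise, and the linearization moves the direction by the
inverse implicit matrix. -/

/-! ### Total variation limits and contraction of weighted oscillations. -/

section Harris

variable {S : Type*} [MeasurableSpace S]

/-- A sequence of probability measures that is Cauchy in total variation converges. -/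
theorem exists_isProbabilityMeasure_tendsto_integral (μ : ℕ → Measure S)
    [∀ n, IsProbabilityMeasure (μ n)] (ε : ℕ → ℝ) (hε : Filter.Tendsto ε Filter.atTop (nhds 0))
    (h : ∀ n m, n ≤ m → ∀ φ : S → ℝ, Measurable φ → (∀ x, |φ x| ≤ 1) →
      |∫ x, φ x ∂μ n - ∫ x, φ x ∂μ m| ≤ ε n) :
    ∃ ν : Measure S, IsProbabilityMeasure ν ∧ ∀ φ : S → ℝ, Measurable φ → (∀ x, |φ x| ≤ 1) →
      Filter.Tendsto (fun n => ∫ x, φ x ∂μ n) Filter.atTop (nhds (∫ x, φ x ∂ν)) := by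
  classical
  -- A finite measure dominating every `μ n`. Passing to densities turns the total variation Cauchy
  -- property into the Cauchy property in the complete space `L¹(π)`; the sign of `f n - f m` is the
  -- test function that recovers the `L¹` distance.
  let π : Measure S := Measure.sum fun n => ((2 : ENNReal)⁻¹ ^ (n + 1)) • μ n
  have hπ : IsFiniteMeasure π := by
    refine ⟨?_⟩
    rw [Measure.sum_apply _ MeasurableSet.univ]
    simp [ENNReal.tsum_geometric_add_one, ENNReal.mul_lt_top]
  have hac : ∀ n, μ n ≪ π := fun n => by
    refine Measure.AbsolutelyContinuous.mk fun s hs h0 => ?_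
    rw [Measure.sum_apply _ hs, ENNReal.tsum_eq_zero] at h0
    have := h0 n
    simpa using this
  let f : ℕ → S → ℝ := fun n x => ((μ n).rnDeriv π x).toReal
  have hfm : ∀ n, Measurable (f n) := fun n => (Measure.measurable_rnDeriv _ _).ennreal_toReal
  have hfi : ∀ n, Integrable (f n) π := fun n => Measure.integrable_toReal_rnDeriv
  have hfint : ∀ n (φ : S → ℝ), ∫ x, f n x * φ x ∂π = ∫ x, φ x ∂μ n := fun n φ => by
    simpa [smul_eq_mul] using integral_rnDeriv_smul (f := φ) (hac n)
  have hmul : ∀ (g : S → ℝ), Integrable g π → ∀ φ : S → ℝ, Measurable φ → (∀ x, |φ x| ≤ 1) →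
      Integrable (fun x => g x * φ x) π := fun g hg φ hφ hφ1 => by
    refine hg.mul_bdd (c := 1) hφ.aestronglyMeasurable (Filter.Eventually.of_forall fun x => ?_)
    simpa using hφ1 x
  have hL1 : ∀ n m, n ≤ m → ∫ x, |f n x - f m x| ∂π ≤ ε n := by
    intro n m hnm
    let φ : S → ℝ := fun x => if f m x ≤ f n x then 1 else -1
    have hφ : Measurable φ :=
      Measurable.ite (measurableSet_le (hfm m) (hfm n)) measurable_const measurable_const
    have hφ1 : ∀ x, |φ x| ≤ 1 := fun x => by
      by_cases hx : f m x ≤ f n x <;> simp [φ, hx]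
    have hcong : ∫ x, |f n x - f m x| ∂π = ∫ x, (f n x * φ x - f m x * φ x) ∂π := by
      refine integral_congr_ae (Filter.Eventually.of_forall fun x => ?_)
      by_cases hx : f m x ≤ f n x
      · simp [φ, hx]
      · simp only [φ, hx, if_false]
        rw [abs_of_nonpos (by linarith [not_le.1 hx])]
        ring
    rw [hcong, integral_sub (hmul _ (hfi n) φ hφ hφ1) (hmul _ (hfi m) φ hφ hφ1), hfint, hfint]
    exact (le_abs_self _).trans (h n m hnm φ hφ hφ1)
  let F : ℕ → (S →₁[π] ℝ) := fun n => (hfi n).toL1 (f n)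
  have hFdist : ∀ n m, n ≤ m → dist (F n) (F m) ≤ ε n := fun n m hnm => by
    rw [L1.dist_eq_integral_dist]
    refine le_trans (le_of_eq (integral_congr_ae ?_)) (hL1 n m hnm)
    filter_upwards [(hfi n).coeFn_toL1, (hfi m).coeFn_toL1] with x h1 h2
    rw [h1, h2, Real.dist_eq]
  have hcau : CauchySeq F := by
    rw [Metric.cauchySeq_iff']
    intro δ hδ
    obtain ⟨n, hn⟩ := (hε.eventually (gt_mem_nhds hδ)).exists
    refine ⟨n, fun m hm => ?_⟩
    rw [dist_comm]
    exact (hFdist n m hm).trans_lt hn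
  obtain ⟨G, hG⟩ := cauchySeq_tendsto_of_complete hcau
  -- The positive part makes the limit an honest density. Since each `f n` is nonnegative,
  -- truncation does not increase the distance to it.
  have hGi : Integrable (fun x => max (G x) 0) π := (L1.integrable_coeFn G).pos_part
  have hGdist : Filter.Tendsto (fun n => ∫ x, |f n x - max (G x) 0| ∂π) Filter.atTop
      (nhds 0) := by
    refine squeeze_zero (fun n => integral_nonneg fun x => abs_nonneg _) (fun n => ?_)
      (tendsto_iff_dist_tendsto_zero.1 hG)
    rw [L1.dist_eq_integral_dist]
    refine integral_mono_ae ((hfi n).sub hGi).abs ?_ ?_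
    · simpa [Real.dist_eq] using ((L1.integrable_coeFn (F n)).sub (L1.integrable_coeFn G)).abs
    · filter_upwards [(hfi n).coeFn_toL1] with x h1
      simp only [F, h1, Real.dist_eq]
      have h0 : 0 ≤ f n x := ENNReal.toReal_nonneg
      rw [← max_eq_left h0]
      exact abs_max_sub_max_le_abs _ _ _ |>.trans (by rw [max_eq_left h0])
  let ν : Measure S := π.withDensity fun x => ENNReal.ofReal (max (G x) 0)
  have hνint : ∀ φ : S → ℝ, ∫ x, φ x ∂ν = ∫ x, max (G x) 0 * φ x ∂π := fun φ => by
    rw [integral_withDensity_eq_integral_toReal_smul₀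
      (hGi.aemeasurable.ennreal_ofReal) (by simp)]
    refine integral_congr_ae (Filter.Eventually.of_forall fun x => ?_)
    simp only [smul_eq_mul]
    rw [ENNReal.toReal_ofReal (le_max_right _ _)]
  have hlim : ∀ φ : S → ℝ, Measurable φ → (∀ x, |φ x| ≤ 1) →
      Filter.Tendsto (fun n => ∫ x, φ x ∂μ n) Filter.atTop (nhds (∫ x, φ x ∂ν)) := by
    intro φ hφ hφ1
    rw [tendsto_iff_dist_tendsto_zero]
    refine squeeze_zero (fun n => dist_nonneg) (fun n => ?_) hGdist
    rw [hνint, ← hfint, Real.dist_eq,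
      ← integral_sub (hmul _ (hfi n) φ hφ hφ1) (hmul _ hGi φ hφ hφ1)]
    refine (abs_integral_le_integral_abs).trans (integral_mono_ae ?_ ((hfi n).sub hGi).abs ?_)
    · exact ((hmul _ (hfi n) φ hφ hφ1).sub (hmul _ hGi φ hφ hφ1)).abs
    · refine Filter.Eventually.of_forall fun x => ?_
      simp only
      rw [← sub_mul, abs_mul]
      exact mul_le_of_le_one_right (abs_nonneg _) (hφ1 x)
  have hνfin : IsFiniteMeasure ν := isFiniteMeasure_withDensity_ofReal hGi.2
  refine ⟨ν, ⟨?_⟩, hlim⟩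
  have h1 := hlim (fun _ => 1) measurable_const (by simp)
  simp only [integral_const, smul_eq_mul, mul_one, probReal_univ] at h1
  have h2 : ν.real Set.univ = 1 := (tendsto_nhds_unique h1 tendsto_const_nhds)
  rw [Measure.real, ENNReal.toReal_eq_one_iff] at h2
  exact h2

/-- The Foster-Lyapunov drift condition `κ V ≤ γ V + K`. -/
def HasDrift (κ : Kernel S S) (V : S → ℝ) (γ K : ℝ) : Prop :=
  ∀ z, Integrable V (κ z) ∧ ∫ y, V y ∂κ z ≤ γ * V z + K

/-- The oscillation of `φ` is at most `L` for the weight `1 + b V`. -/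
def OscBound (V : S → ℝ) (b L : ℝ) (φ : S → ℝ) : Prop :=
  ∀ x y, |φ x - φ y| ≤ L * (2 + b * V x + b * V y)

/-- The constant `K / (1 - γ)` is the fixed point of `x ↦ γ x + K`, that is the sum of the geometric
series of errors, so one additive constant serves all powers. -/
theorem HasDrift.pow {κ : Kernel S S} [IsMarkovKernel κ] {V : S → ℝ} {γ K : ℝ}
    (hκ : HasDrift κ V γ K) (hVm : Measurable V) (hV : ∀ z, 0 ≤ V z) (hγ : 0 ≤ γ) (hγ1 : γ < 1)
    (hK : 0 ≤ K) (n : ℕ) : IsMarkovKernel (κ ^ n) ∧ HasDrift (κ ^ n) V (γ ^ n) (K / (1 - γ)) := by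
  have hK' : 0 ≤ K / (1 - γ) := div_nonneg hK (by linarith)
  induction n with
  | zero =>
    have h1 : κ ^ 0 = Kernel.id := rfl
    rw [h1]
    refine ⟨inferInstance, fun z => ⟨?_, ?_⟩⟩
    · rw [Kernel.id_apply]
      exact integrable_dirac' hVm.stronglyMeasurable (by simp)
    · rw [Kernel.id_apply, integral_dirac' _ _ hVm.stronglyMeasurable]
      simpa using hK'
  | succ n ih =>
    obtain ⟨hM, ih⟩ := ih
    have h1 : κ ^ (n + 1) = κ ∘ₖ (κ ^ n) := pow_succ' κ n
    rw [h1]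
    refine ⟨inferInstance, fun z => ?_⟩
    have hm : Measurable fun y => ∫ x, V x ∂κ y :=
      (hVm.stronglyMeasurable.integral_kernel (κ := κ)).measurable
    have hdom : Integrable (fun y => γ * V y + K) ((κ ^ n) z) :=
      ((ih z).1.const_mul γ).add (integrable_const K)
    have hii : Integrable (fun y => ∫ x, V x ∂κ y) ((κ ^ n) z) := by
      refine hdom.mono' hm.aestronglyMeasurable (Filter.Eventually.of_forall fun y => ?_)
      rw [Real.norm_of_nonneg (integral_nonneg hV)]
      exact (hκ y).2
    have hint : Integrable V ((κ ∘ₖ (κ ^ n)) z) := by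
      rw [integrable_comp_iff hVm.aestronglyMeasurable]
      refine ⟨Filter.Eventually.of_forall fun y => (hκ y).1, ?_⟩
      simpa only [Real.norm_of_nonneg (hV _)] using hii
    refine ⟨hint, ?_⟩
    rw [Kernel.integral_comp hint]
    calc ∫ y, ∫ x, V x ∂κ y ∂(κ ^ n) z ≤ ∫ y, (γ * V y + K) ∂(κ ^ n) z :=
          integral_mono hii hdom fun y => (hκ y).2
      _ = γ * ∫ y, V y ∂(κ ^ n) z + K := by
          rw [integral_add ((ih z).1.const_mul γ) (integrable_const K), integral_const_mul]
          simp
      _ ≤ γ * (γ ^ n * V z + K / (1 - γ)) + K := by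
          gcongr
          exact (ih z).2
      _ = γ ^ (n + 1) * V z + K / (1 - γ) := by
          have : (1 - γ) ≠ 0 := by linarith
          field_simp
          ring

/-- The intervals `φ x ± L (1 + b V x)` intersect pairwise, hence have a common point, the supremum
of their left endpoints. The oscillation seminorm is thus a weighted sup norm modulo constants. -/
theorem OscBound.exists_abs_sub_le {T : Type*} [Nonempty T] {V φ : T → ℝ} {b L : ℝ}
    (h : OscBound V b L φ) : ∃ a, ∀ x, |φ x - a| ≤ L * (1 + b * V x) := by
  have hbd : ∀ x y, φ x - L * (1 + b * V x) ≤ φ y + L * (1 + b * V y) := fun x y => by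
    have := (abs_le.1 (h x y)).2
    linarith
  have hB : BddAbove (Set.range fun x => φ x - L * (1 + b * V x)) := by
    obtain ⟨y⟩ := ‹Nonempty T›
    exact ⟨_, by rintro _ ⟨x, rfl⟩; exact hbd x y⟩
  refine ⟨⨆ x, (φ x - L * (1 + b * V x)), fun x => abs_le.2 ⟨?_, ?_⟩⟩
  · have := ciSup_le fun y => hbd y x
    linarith
  · have := le_ciSup hB x
    linarith

theorem integrable_of_abs_le_affine {V φ : S → ℝ} {μ : Measure S} [IsFiniteMeasure μ]
    (hV : Integrable V μ) (hφ : Measurable φ) {A B : ℝ} (h : ∀ x, |φ x| ≤ A + B * V x) :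
    Integrable φ μ :=
  ((integrable_const A).add (hV.const_mul B)).mono' hφ.aestronglyMeasurable
    (Filter.Eventually.of_forall h)

theorem OscBound.integrable {V : S → ℝ} {b L : ℝ} {φ : S → ℝ}
    (h : OscBound V b L φ) (hφ : Measurable φ) {μ : Measure S} [IsFiniteMeasure μ]
    (hV : Integrable V μ) : Integrable φ μ := by
  rcases isEmpty_or_nonempty S with hS | hS
  · exact Integrable.of_isEmpty
  obtain ⟨a, ha⟩ := h.exists_abs_sub_le
  refine integrable_of_abs_le_affine hV hφ (A := |a| + L) (B := L * b) fun x => ?_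
  have := abs_add_le (φ x - a) a
  rw [sub_add_cancel] at this
  linarith [ha x]

theorem abs_integral_sub_le {V : S → ℝ} {A B : ℝ} {φ : S → ℝ} {a : ℝ}
    (hφ : Measurable φ) {μ : Measure S} [IsProbabilityMeasure μ]
    (hV : Integrable V μ) (ha : ∀ x, |φ x - a| ≤ A + B * V x) :
    |∫ x, φ x ∂μ - a| ≤ A + B * ∫ x, V x ∂μ := by
  have hi : Integrable (fun x => φ x - a) μ :=
    integrable_of_abs_le_affine hV (hφ.sub measurable_const) ha
  have hi' : Integrable φ μ :=
    (hi.add (integrable_const a)).congr (Filter.Eventually.of_forall fun x => sub_add_cancel _ _)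
  have hdom : Integrable (fun x => A + B * V x) μ := (integrable_const A).add (hV.const_mul B)
  have h1 : ∫ x, φ x ∂μ - a = ∫ x, (φ x - a) ∂μ := by
    rw [integral_sub hi' (integrable_const a)]; simp
  rw [h1]
  refine abs_integral_le_integral_abs.trans ((integral_mono hi.abs hdom ha).trans (le_of_eq ?_))
  rw [integral_add (integrable_const A) (hV.const_mul B), integral_const_mul]
  simp

/-- Contraction of the weighted oscillation by a Markov kernel that satisfies a drift condition
and a minorization condition on a sublevel set of the Lyapunov function. -/
theorem exists_contraction [Nonempty S] (Q : Kernel S S) [IsMarkovKernel Q] {V : S → ℝ} {γ K : ℝ}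
    (hQ : HasDrift Q V γ K) (hV : ∀ z, 0 ≤ V z) (hγ1 : γ < 1)
    (hK : 0 ≤ K) {R : ℝ} (hR0 : 0 < R) (hR : 4 * K ≤ (1 - γ) * R) (m : Measure S)
    [IsProbabilityMeasure m] {c : ℝ} (hc : 0 < c) (hc1 : c ≤ 1)
    (hm : ∀ z, V z ≤ R → ENNReal.ofReal c • m ≤ Q z) :
    ∃ b ρ : ℝ, 0 < b ∧ b ≤ 1 ∧ 0 < ρ ∧ ρ < 1 ∧ ∀ (φ : S → ℝ) (L : ℝ), Measurable φ → 0 ≤ L →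
      OscBound V b L φ → OscBound V b (ρ * L) fun z => ∫ y, φ y ∂Q z := by
  -- A small weight on `V` gives `2 b K ≤ c`: the additive drift error then uses up at most half of
  -- the gain `2 c` from the minorization.
  set b : ℝ := c / (2 * K + 1) with hb
  have hb0 : 0 < b := by positivity
  have hb1 : b ≤ 1 := by
    rw [hb, div_le_one (by positivity)]; linarith
  have hbK : 2 * b * K ≤ c := by
    have : b * (2 * K + 1) = c := by rw [hb]; field_simp
    nlinarith
  -- The value at `t = b R` of the increasing function `t / (2 + t)`. It measures the least share of
  -- the weight `2 + b V x + b V y` carried by `V` when `V x + V y ≥ R`. In that case drift alone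
  -- contracts; otherwise both points lie in the sublevel set and the minorization applies. The
  -- three terms of `ρ` come from these two cases.
  set s : ℝ := b * R / (2 + b * R) with hs
  have hs0 : 0 < s := by positivity
  have hs1 : s < 1 := by
    rw [hs, div_lt_one (by positivity)]; linarith
  set ρ : ℝ := max (max (1 - c / 2) γ) (1 - (1 - γ) / 2 * s) with hρ
  have hρ1 : 1 - c / 2 ≤ ρ := (le_max_left _ _).trans (le_max_left _ _)
  have hρ2 : γ ≤ ρ := (le_max_right _ _).trans (le_max_left _ _)
  have hρ3 : 1 - (1 - γ) / 2 * s ≤ ρ := le_max_right _ _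
  refine ⟨b, ρ, hb0, hb1, by linarith, ?_, ?_⟩
  · rw [hρ]
    refine max_lt (max_lt (by linarith) hγ1) ?_
    have : 0 < (1 - γ) / 2 * s := mul_pos (by linarith) hs0
    linarith
  intro φ L hφ hL hosc
  obtain ⟨a, ha⟩ := hosc.exists_abs_sub_le
  have ha' : ∀ x, |φ x - a| ≤ L + (L * b) * V x := fun x => (ha x).trans (by ring_nf; rfl)
  intro x y
  have key : L * (2 + b * (∫ z, V z ∂Q x) + b * ∫ z, V z ∂Q y)
      ≤ L * (2 + b * γ * (V x + V y) + 2 * b * K) := by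
    have h1 := (hQ x).2
    have h2 := (hQ y).2
    refine mul_le_mul_of_nonneg_left ?_ hL
    nlinarith
  rcases le_total R (V x + V y) with hS | hS
  · have h1 := abs_integral_sub_le hφ (hQ x).1 ha'
    have h2 := abs_integral_sub_le hφ (hQ y).1 ha'
    have h3 : |∫ z, φ z ∂Q x - ∫ z, φ z ∂Q y|
        ≤ L * (2 + b * (∫ z, V z ∂Q x) + b * ∫ z, V z ∂Q y) := by
      have := abs_sub_le (∫ z, φ z ∂Q x) a (∫ z, φ z ∂Q y)
      rw [abs_sub_comm a] at this
      linarith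
    refine (h3.trans key).trans ?_
    rw [mul_comm ρ, mul_assoc L ρ]
    refine mul_le_mul_of_nonneg_left ?_ hL
    have ht : b * R ≤ b * (V x + V y) := mul_le_mul_of_nonneg_left hS hb0.le
    have h5 : s * (2 + b * (V x + V y)) ≤ b * (V x + V y) := by
      rw [hs, div_mul_eq_mul_div, div_le_iff₀ (by positivity)]
      nlinarith
    have h6 : (1 - (1 - γ) / 2 * s) * (2 + b * (V x + V y)) ≤ ρ * (2 + b * (V x + V y)) :=
      mul_le_mul_of_nonneg_right hρ3 (by nlinarith [hV x, hV y])
    have h7 : b * (4 * K) ≤ b * ((1 - γ) * (V x + V y)) := by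
      refine mul_le_mul_of_nonneg_left (hR.trans ?_) hb0.le
      exact mul_le_mul_of_nonneg_left hS (by linarith)
    have h8 : (1 - γ) / 2 * (s * (2 + b * (V x + V y))) ≤ (1 - γ) / 2 * (b * (V x + V y)) :=
      mul_le_mul_of_nonneg_left h5 (by linarith)
    nlinarith
  · have hVm : ∀ z, V z ≤ R → Integrable V m := fun z hz => by
      have h1 : Integrable V (ENNReal.ofReal c • m) := (hQ z).1.mono_measure (hm z hz)
      rwa [integrable_smul_measure (by simpa using hc) (by simp)] at h1
    have hx : V x ≤ R := by linarith [hV y]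
    have hy : V y ≤ R := by linarith [hV x]
    have hVmi := hVm x hx
    obtain ⟨T, hT⟩ : ∃ T, T = ∫ u, (φ u - a) ∂m := ⟨_, rfl⟩
    -- The common part `c • m` contributes the same amount `c T` at both points and cancels. The
    -- remainder `Q z - c • m` is a positive measure of mass `1 - c`.
    have hres : ∀ z, V z ≤ R → |∫ u, φ u ∂Q z - a - c * T|
        ≤ L * (1 - c + b * ∫ u, V u ∂Q z) := by
      intro z hz
      have hiQ : Integrable (fun u => φ u - a) (Q z) :=
        integrable_of_abs_le_affine (hQ z).1 (hφ.sub measurable_const) ha'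
      have him : Integrable (fun u => φ u - a) m :=
        integrable_of_abs_le_affine hVmi (hφ.sub measurable_const) ha'
      have hiQ' : Integrable φ (Q z) :=
        (hiQ.add (integrable_const a)).congr
          (Filter.Eventually.of_forall fun u => sub_add_cancel _ _)
      have hVmeas : ∀ μ : Measure S, IsProbabilityMeasure μ → Integrable V μ →
          ∫ u, (L + L * b * V u) ∂μ = L + L * b * ∫ u, V u ∂μ := by
        intro μ _ hi
        rw [integral_add (integrable_const _) (hi.const_mul _), integral_const_mul]
        simp
      have hiV : Integrable (fun u => L + L * b * V u) (Q z) :=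
        (integrable_const L).add ((hQ z).1.const_mul _)
      have hiVm : Integrable (fun u => L + L * b * V u) m :=
        (integrable_const L).add (hVmi.const_mul _)
      have hlow : ∀ ψ : S → ℝ, (∀ u, 0 ≤ ψ u) →
          Integrable ψ (Q z) → c * ∫ u, ψ u ∂m ≤ ∫ u, ψ u ∂Q z := by
        intro ψ hψ0 hψi
        have h1 : ∫ u, ψ u ∂(ENNReal.ofReal c • m) ≤ ∫ u, ψ u ∂Q z :=
          integral_mono_measure (hm z hz) (Filter.Eventually.of_forall hψ0) hψi
        rwa [integral_smul_measure, ENNReal.toReal_ofReal hc.le, smul_eq_mul] at h1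
      have e0 : ∫ u, (φ u - a) ∂Q z = ∫ u, φ u ∂Q z - a := by
        rw [integral_sub hiQ' (integrable_const a)]; simp
      have hmV : 0 ≤ ∫ u, V u ∂m := integral_nonneg hV
      have hLb : 0 ≤ c * (L * b * ∫ u, V u ∂m) := by positivity
      have e1 := hlow (fun u => (L + L * b * V u) + (φ u - a))
        (fun u => by linarith [(abs_le.1 (ha' u)).1]) (hiV.add hiQ)
      have e2 := hlow (fun u => (L + L * b * V u) - (φ u - a))
        (fun u => by linarith [(abs_le.1 (ha' u)).2]) (hiV.sub hiQ)
      rw [integral_add hiV hiQ, integral_add hiVm him, hVmeas _ inferInstance (hQ z).1,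
        hVmeas _ inferInstance hVmi, e0, ← hT] at e1
      rw [integral_sub hiV hiQ, integral_sub hiVm him, hVmeas _ inferInstance (hQ z).1,
        hVmeas _ inferInstance hVmi, e0, ← hT] at e2
      rw [abs_le]
      constructor <;> nlinarith
    have h3 : |∫ z, φ z ∂Q x - ∫ z, φ z ∂Q y|
        ≤ L * (2 + b * (∫ z, V z ∂Q x) + b * ∫ z, V z ∂Q y) - 2 * c * L := by
      have := abs_sub_le (∫ z, φ z ∂Q x - a - c * T) 0 (∫ z, φ z ∂Q y - a - c * T)
      rw [sub_zero, zero_sub, abs_neg] at this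
      have e : ∫ z, φ z ∂Q x - a - c * T - (∫ z, φ z ∂Q y - a - c * T)
        = ∫ z, φ z ∂Q x - ∫ z, φ z ∂Q y := by ring
      rw [e] at this
      linarith [hres x hx, hres y hy]
    have h4 : L * (2 + b * γ * (V x + V y) + 2 * b * K) - 2 * c * L
        ≤ ρ * L * (2 + b * V x + b * V y) := by
      have h5 : 2 + b * γ * (V x + V y) + 2 * b * K - 2 * c ≤ ρ * (2 + b * V x + b * V y) := by
        have : γ * (b * (V x + V y)) ≤ ρ * (b * (V x + V y)) :=
          mul_le_mul_of_nonneg_right hρ2 (mul_nonneg hb0.le (by linarith [hV x, hV y]))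
        nlinarith
      nlinarith [mul_le_mul_of_nonneg_left h5 hL]
    linarith

end Harris

/-! ### Geometric ergodicity from drift and minorization. -/

section Ergodic

variable {S : Type*} [MeasurableSpace S]

/-- A crude bound from the drift condition alone, used for the `n % N` steps left over after whole
blocks of length `N`. -/
theorem OscBound.kernel {κ : Kernel S S} [IsMarkovKernel κ] {V : S → ℝ} {γ K b L : ℝ}
    (hκ : HasDrift κ V γ K) (hV : ∀ z, 0 ≤ V z) (hγ1 : γ ≤ 1) (hK : 0 ≤ K)
    (hb : 0 ≤ b) (hb1 : b ≤ 1) (hL : 0 ≤ L) {φ : S → ℝ} (hφ : Measurable φ)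
    (h : OscBound V b L φ) : OscBound V b ((1 + K) * L) fun z => ∫ y, φ y ∂κ z := by
  intro x y
  have : Nonempty S := ⟨x⟩
  obtain ⟨a, ha⟩ := h.exists_abs_sub_le
  have ha' : ∀ x, |φ x - a| ≤ L + (L * b) * V x := fun x => (ha x).trans (by ring_nf; rfl)
  have h1 := abs_integral_sub_le hφ (hκ x).1 ha'
  have h2 := abs_integral_sub_le hφ (hκ y).1 ha'
  have h3 := abs_sub_le (∫ z, φ z ∂κ x) a (∫ z, φ z ∂κ y)
  rw [abs_sub_comm a] at h3
  have hLb : 0 ≤ L * b := mul_nonneg hL hb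
  have h4 : L * b * ∫ z, V z ∂κ x ≤ L * b * (V x + K) :=
    mul_le_mul_of_nonneg_left ((hκ x).2.trans (by nlinarith [hV x])) hLb
  have h5 : L * b * ∫ z, V z ∂κ y ≤ L * b * (V y + K) :=
    mul_le_mul_of_nonneg_left ((hκ y).2.trans (by nlinarith [hV y])) hLb
  have h6 : L * b * K ≤ L * K := by
    have := mul_le_mul_of_nonneg_left hb1 (mul_nonneg hL hK)
    nlinarith
  have h7 : 0 ≤ K * L * (b * V x + b * V y) := by
    have := hV x
    have := hV y
    positivity
  nlinarith

theorem integral_pow_add {κ : Kernel S S} {φ : S → ℝ} (n k : ℕ) (z : S)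
    (hi : Integrable φ ((κ ^ (n + k)) z)) :
    ∫ x, φ x ∂(κ ^ (n + k)) z = ∫ y, ∫ x, φ x ∂(κ ^ n) y ∂(κ ^ k) z := by
  rw [Kernel.pow_add] at hi ⊢
  exact Kernel.integral_comp hi

theorem integral_bind_kernel {κ : Kernel S S} {φ : S → ℝ} {μ : Measure S}
    (hi : Integrable φ (μ.bind κ)) : ∫ x, φ x ∂μ.bind κ = ∫ y, ∫ x, φ x ∂κ y ∂μ := by
  rw [Measure.comp_eq_comp_const_apply] at hi ⊢
  exact Kernel.integral_comp hi

theorem measurable_integral_kernel {κ : Kernel S S} [IsMarkovKernel κ] {φ : S → ℝ}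
    (hφ : Measurable φ) : Measurable fun z => ∫ y, φ y ∂κ z :=
  (hφ.stronglyMeasurable.integral_kernel (κ := κ)).measurable

/-- Geometric decay of the weighted oscillation along a Markov chain, when some power of the kernel
satisfies a minorization condition. -/
theorem exists_oscBound_pow [Nonempty S] (κ : Kernel S S) [IsMarkovKernel κ] {V : S → ℝ} {γ K : ℝ}
    (hκ : HasDrift κ V γ K) (hVm : Measurable V) (hV : ∀ z, 0 ≤ V z) (hγ : 0 ≤ γ) (hγ1 : γ < 1)
    (hK : 0 ≤ K)
    (hmin : ∀ R : ℝ, ∃ N : ℕ, N ≠ 0 ∧ ∃ m : Measure S, IsProbabilityMeasure m ∧ ∃ c : ℝ, 0 < c ∧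
      c ≤ 1 ∧ ∀ z, V z ≤ R → ENNReal.ofReal c • m ≤ (κ ^ N) z) :
    ∃ b C ρ : ℝ, 0 < b ∧ b ≤ 1 ∧ 0 < C ∧ 0 < ρ ∧ ρ < 1 ∧
      ∀ (φ : S → ℝ) (L : ℝ), Measurable φ → 0 ≤ L → OscBound V b L φ →
        ∀ n : ℕ, OscBound V b (C * ρ ^ n * L) fun z => ∫ y, φ y ∂(κ ^ n) z := by
  have hK' : 0 ≤ K / (1 - γ) := div_nonneg hK (by linarith)
  obtain ⟨N, hN, m, hmP, c, hc, hc1, hm⟩ := hmin (4 * (K / (1 - γ)) / (1 - γ) + 1)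
  have hpow := fun n => hκ.pow hVm hV hγ hγ1 hK n
  have hMk : ∀ n, IsMarkovKernel (κ ^ n) := fun n => (hpow n).1
  have hγN : γ ^ N ≤ γ := pow_le_of_le_one hγ hγ1.le hN
  have hR0 : 0 < 4 * (K / (1 - γ)) / (1 - γ) + 1 := by
    have : 0 ≤ 4 * (K / (1 - γ)) / (1 - γ) := div_nonneg (by linarith) (by linarith)
    linarith
  have hRK : 4 * (K / (1 - γ)) ≤ (1 - γ ^ N) * (4 * (K / (1 - γ)) / (1 - γ) + 1) := by
    have h1 : (1 - γ) * (4 * (K / (1 - γ)) / (1 - γ) + 1) = 4 * (K / (1 - γ)) + (1 - γ) := by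
      have : (1 - γ) ≠ 0 := by linarith
      field_simp
    nlinarith
  obtain ⟨b, r, hb, hb1, hr, hr1, hcon⟩ := exists_contraction (κ ^ N) (hpow N).2 hV
    (hγN.trans_lt hγ1) hK' hR0 hRK m hc hc1 hm
  have hiter : ∀ (φ : S → ℝ) (L : ℝ), Measurable φ → 0 ≤ L → OscBound V b L φ →
      ∀ q : ℕ, OscBound V b (r ^ q * L) fun z => ∫ y, φ y ∂(κ ^ (N * q)) z := by
    intro φ L hφ hL h q
    induction q with
    | zero =>
      have h1 : κ ^ (N * 0) = Kernel.id := rfl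
      simp only [h1, Kernel.id_apply, integral_dirac' _ _ hφ.stronglyMeasurable]
      simpa using h
    | succ q ih =>
      have h1 := hcon _ _ (measurable_integral_kernel hφ) (by positivity) ih
      have h2 : r * (r ^ q * L) = r ^ (q + 1) * L := by ring
      rw [h2] at h1
      have h3 : (fun z => ∫ y, φ y ∂(κ ^ (N * (q + 1))) z)
          = fun z => ∫ y, ∫ x, φ x ∂(κ ^ (N * q)) y ∂(κ ^ N) z := by
        funext z
        rw [mul_add, mul_one]
        exact integral_pow_add _ _ _ (h.integrable hφ ((hpow _).2 z).1)
      rwa [h3]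
  -- The rate per step is the `N`-th root of the rate per block. Rounding `n / N` down costs at most
  -- one factor `r`, which is why `r` divides the constant chosen below.
  obtain ⟨ρ, hρ, hρ1, hρN⟩ : ∃ ρ : ℝ, 0 < ρ ∧ ρ < 1 ∧ ρ ^ N = r :=
    ⟨r ^ ((N : ℝ)⁻¹), Real.rpow_pos_of_pos hr _,
      Real.rpow_lt_one hr.le hr1 (by positivity), Real.rpow_inv_natCast_pow hr.le hN⟩
  refine ⟨b, (1 + K / (1 - γ)) / r, ρ, hb, hb1, by positivity, hρ, hρ1, ?_⟩
  intro φ L hφ hL h n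
  have h1 := hiter φ L hφ hL h (n / N)
  have h2 := OscBound.kernel (hpow (n % N)).2 hV (pow_le_one₀ hγ hγ1.le) hK' hb.le hb1
    (by positivity) (measurable_integral_kernel hφ) h1
  have h3 : (fun z => ∫ y, φ y ∂(κ ^ n) z)
      = fun z => ∫ y, ∫ x, φ x ∂(κ ^ (N * (n / N))) y ∂(κ ^ (n % N)) z := by
    funext z
    have h4 : n = N * (n / N) + n % N := (Nat.div_add_mod n N).symm
    have h5 := integral_pow_add (κ := κ) (φ := φ) (N * (n / N)) (n % N) z
      (h.integrable hφ ((hpow _).2 z).1)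
    rwa [← h4] at h5
  rw [h3]
  intro x y
  refine (h2 x y).trans (mul_le_mul_of_nonneg_right ?_ ?_)
  · have h6 : r ^ (n / N) * r ≤ ρ ^ n := by
      rw [← pow_succ, ← hρN, ← pow_mul]
      refine pow_le_pow_of_le_one hρ.le hρ1.le ?_
      have := Nat.div_add_mod n N
      have := Nat.mod_lt n (Nat.pos_of_ne_zero hN)
      rw [mul_add]
      omega
    have h7 : r ^ (n / N) ≤ ρ ^ n / r := by rwa [le_div_iff₀ hr]
    calc (1 + K / (1 - γ)) * (r ^ (n / N) * L) ≤ (1 + K / (1 - γ)) * (ρ ^ n / r * L) := by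
          gcongr
      _ = (1 + K / (1 - γ)) / r * ρ ^ n * L := by ring
  · have := hV x
    have := hV y
    positivity

/-- A kernel whose iterates converge setwise to `ν` from every point has at most one invariant
probability measure. -/
theorem eq_of_bind_eq_of_tendsto {κ : Kernel S S} [IsMarkovKernel κ] {ν ν' : Measure S}
    [IsProbabilityMeasure ν] [IsProbabilityMeasure ν'] (hν' : ν'.bind κ = ν')
    (h : ∀ A, MeasurableSet A → ∀ z, Filter.Tendsto (fun n : ℕ => ((κ ^ n) z).real A) Filter.atTop
      (nhds (ν.real A))) (hM : ∀ n : ℕ, IsMarkovKernel (κ ^ n)) : ν' = ν := by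
  have hinv : ∀ n : ℕ, ν'.bind (κ ^ n) = ν' := by
    intro n
    induction n with
    | zero => exact Measure.bind_dirac
    | succ n ih =>
      have h1 : κ ^ (n + 1) = (κ ^ n) ∘ₖ κ := pow_succ κ n
      rw [h1, ← Measure.comp_assoc, hν', ih]
  ext A hA
  have h1 : Filter.Tendsto (fun n : ℕ => ∫ z, ((κ ^ n) z).real A ∂ν') Filter.atTop
      (nhds (∫ _, ν.real A ∂ν')) := by
    refine tendsto_integral_of_dominated_convergence (fun _ => 1) (fun n => ?_)
      (integrable_const _) (fun n => Filter.Eventually.of_forall fun z => ?_)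
      (Filter.Eventually.of_forall fun z => h A hA z)
    · exact (Kernel.measurable_coe (κ ^ n) hA).ennreal_toReal.aestronglyMeasurable
    · rw [Real.norm_of_nonneg measureReal_nonneg]
      exact measureReal_le_one
  have h2 : ∀ n : ℕ, ∫ z, ((κ ^ n) z).real A ∂ν' = ν'.real A := by
    intro n
    have h3 : ν'.real A = (ν'.bind (κ ^ n)).real A := by rw [hinv]
    rw [h3, Measure.real, Measure.bind_apply hA (Kernel.aemeasurable _)]
    exact integral_toReal (Kernel.measurable_coe (κ ^ n) hA).aemeasurable
      (Filter.Eventually.of_forall fun z => measure_lt_top _ _)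
  simp only [h2] at h1
  have h4 := tendsto_nhds_unique tendsto_const_nhds h1
  simp only [integral_const, probReal_univ, one_smul] at h4
  exact (measureReal_eq_measureReal_iff).1 h4

/-- Harris' theorem: existence of an invariant probability measure and geometric convergence. -/
theorem exists_invariant_geometric [Nonempty S] (κ : Kernel S S) [IsMarkovKernel κ] {V : S → ℝ}
    {γ K : ℝ} (hκ : HasDrift κ V γ K) (hVm : Measurable V) (hV : ∀ z, 0 ≤ V z) (hγ : 0 ≤ γ)
    (hγ1 : γ < 1) (hK : 0 ≤ K)
    (hmin : ∀ R : ℝ, ∃ N : ℕ, N ≠ 0 ∧ ∃ m : Measure S, IsProbabilityMeasure m ∧ ∃ c : ℝ, 0 < c ∧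
      c ≤ 1 ∧ ∀ z, V z ≤ R → ENNReal.ofReal c • m ≤ (κ ^ N) z) :
    ∃ ν : Measure S, IsProbabilityMeasure ν ∧ ν.bind κ = ν ∧ Integrable V ν ∧
      ∃ C ρ : ℝ, 0 < C ∧ 0 < ρ ∧ ρ < 1 ∧ ∀ (φ : S → ℝ) (D : ℝ), Measurable φ →
        (∀ x, |φ x| ≤ D * (1 + V x)) → ∀ (n : ℕ) (z : S), Integrable φ ((κ ^ n) z) ∧
          |∫ y, φ y ∂(κ ^ n) z - ∫ y, φ y ∂ν| ≤ C * ρ ^ n * D * (1 + V z) := by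
  obtain ⟨b, C, ρ, hb, hb1, hC, hρ, hρ1, hosc⟩ :=
    exists_oscBound_pow κ hκ hVm hV hγ hγ1 hK hmin
  have hK' : 0 ≤ K / (1 - γ) := div_nonneg hK (by linarith)
  have hpow := fun n => hκ.pow hVm hV hγ hγ1 hK n
  have hMk : ∀ n : ℕ, IsMarkovKernel (κ ^ n) := fun n => (hpow n).1
  have hVpow : ∀ (n : ℕ) (z : S), ∫ y, V y ∂(κ ^ n) z ≤ V z + K / (1 - γ) := fun n z => by
    have h1 := ((hpow n).2 z).2
    have h2 : γ ^ n * V z ≤ V z := mul_le_of_le_one_left (hV z) (pow_le_one₀ hγ hγ1.le)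
    linarith
  have hdiff : ∀ (φ : S → ℝ) (L : ℝ), Measurable φ → 0 ≤ L → OscBound V b L φ → ∀ (n : ℕ) (z : S)
      (μ : Measure S) [IsProbabilityMeasure μ], Integrable V μ →
      |∫ y, φ y ∂(κ ^ n) z - ∫ x, ∫ y, φ y ∂(κ ^ n) x ∂μ|
        ≤ C * ρ ^ n * L * (2 + b * V z) + C * ρ ^ n * L * b * ∫ x, V x ∂μ := by
    intro φ L hφ hL h n z μ _ hμ
    rw [abs_sub_comm]
    refine abs_integral_sub_le (measurable_integral_kernel hφ) hμ fun x => ?_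
    refine (hosc φ L hφ hL h n x z).trans (le_of_eq ?_)
    ring
  obtain ⟨z₀⟩ := ‹Nonempty S›
  have hone : ∀ φ : S → ℝ, (∀ x, |φ x| ≤ 1) → OscBound V b 1 φ := fun φ h x y => by
    have h1 := abs_sub_le (φ x) 0 (φ y)
    rw [sub_zero, zero_sub, abs_neg] at h1
    have := mul_nonneg hb.le (hV x)
    have := mul_nonneg hb.le (hV y)
    linarith [h x, h y]
  obtain ⟨ν, hνP, hν⟩ := exists_isProbabilityMeasure_tendsto_integral (fun n => (κ ^ n) z₀)
    (fun n => C * ρ ^ n * (2 + 2 * V z₀ + K / (1 - γ)))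
    (by
      have h1 := (tendsto_pow_atTop_nhds_zero_of_lt_one hρ.le hρ1).const_mul C
      simpa using h1.mul_const (2 + 2 * V z₀ + K / (1 - γ)))
    (fun n m hnm φ hφ hφ1 => by
      obtain ⟨k, rfl⟩ := Nat.exists_eq_add_of_le hnm
      rw [integral_pow_add n k z₀ ((hone φ hφ1).integrable hφ ((hpow _).2 _).1)]
      refine (hdiff φ 1 hφ zero_le_one (hone φ hφ1) n z₀ _ ((hpow k).2 z₀).1).trans ?_
      have h1 := hVpow k z₀
      have h2 : 0 ≤ C * ρ ^ n := by positivity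
      have h3 : b * ∫ x, V x ∂(κ ^ k) z₀ ≤ V z₀ + K / (1 - γ) :=
        (mul_le_of_le_one_left (integral_nonneg hV) hb1).trans h1
      have h4 : b * V z₀ ≤ V z₀ := mul_le_of_le_one_left (hV z₀) hb1
      have h5 := mul_le_mul_of_nonneg_left (add_le_add h3 h4) h2
      linarith)
  -- The convergence to `ν` is known only for functions bounded by 1. Hence `V` is truncated at `k +
  -- 1` and rescaled, the uniform moment bound passes to the limit, and monotone convergence removes
  -- the truncation.
  have hVν : Integrable V ν := by
    refine ⟨hVm.aestronglyMeasurable, ?_⟩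
    have hk : ∀ k : ℕ, ∫⁻ x, ENNReal.ofReal (min (V x) (k + 1)) ∂ν
        ≤ ENNReal.ofReal (V z₀ + K / (1 - γ)) := by
      intro k
      have hk0 : (0 : ℝ) < k + 1 := by positivity
      have hm : Measurable fun x => min (V x) (k + 1 : ℝ) := hVm.min measurable_const
      have h0 : ∀ x, 0 ≤ min (V x) (k + 1 : ℝ) := fun x => le_min (hV x) hk0.le
      have hbd : ∀ x, |min (V x) (k + 1 : ℝ) / (k + 1)| ≤ 1 := fun x => by
        rw [abs_of_nonneg (div_nonneg (h0 x) hk0.le), div_le_one hk0]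
        exact min_le_right _ _
      have hint : ∀ μ : Measure S, IsProbabilityMeasure μ →
          Integrable (fun x => min (V x) (k + 1 : ℝ)) μ := fun μ _ =>
        (integrable_const (k + 1 : ℝ)).mono' hm.aestronglyMeasurable
          (Filter.Eventually.of_forall fun x => by
            rw [Real.norm_of_nonneg (h0 x)]; exact min_le_right _ _)
      rw [← ofReal_integral_eq_lintegral_ofReal (hint ν hνP) (Filter.Eventually.of_forall h0)]
      refine ENNReal.ofReal_le_ofReal ?_
      have hlim := (hν _ (hm.div_const (k + 1 : ℝ)) hbd).const_mul (k + 1 : ℝ)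
      simp only [integral_div] at hlim
      rw [mul_div_cancel₀ _ hk0.ne'] at hlim
      refine le_of_tendsto' hlim fun n => ?_
      rw [mul_div_cancel₀ _ hk0.ne']
      exact (integral_mono (hint _ inferInstance) ((hpow n).2 z₀).1 fun x => min_le_left _ _).trans
        (hVpow n z₀)
    have hlim : Filter.Tendsto (fun k : ℕ => ∫⁻ x, ENNReal.ofReal (min (V x) (k + 1)) ∂ν)
        Filter.atTop (nhds (∫⁻ x, ENNReal.ofReal (V x) ∂ν)) := by
      refine lintegral_tendsto_of_tendsto_of_monotone
        (fun k => (hVm.min measurable_const).ennreal_ofReal.aemeasurable)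
        (Filter.Eventually.of_forall fun x i j hij => ?_)
        (Filter.Eventually.of_forall fun x => ?_)
      · have : (i : ℝ) ≤ j := by exact_mod_cast hij
        exact ENNReal.ofReal_le_ofReal (min_le_min_left _ (by linarith))
      · refine tendsto_const_nhds.congr' ?_
        filter_upwards [Filter.eventually_ge_atTop ⌈V x⌉₊] with k hk
        have : V x ≤ k := (Nat.le_ceil _).trans (by exact_mod_cast hk)
        rw [min_eq_left (by linarith)]
    have hle := le_of_tendsto' hlim hk
    rw [hasFiniteIntegral_iff_ofReal (Filter.Eventually.of_forall hV)]
    exact hle.trans_lt ENNReal.ofReal_lt_top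
  have hinv : ν.bind κ = ν := by
    have hP : IsProbabilityMeasure (ν.bind κ) := inferInstance
    ext A hA
    rw [← measureReal_eq_measureReal_iff]
    let φ : S → ℝ := A.indicator 1
    have hφ : Measurable φ := measurable_one.indicator hA
    have hφ1 : ∀ x, |φ x| ≤ 1 := fun x => by
      by_cases hx : x ∈ A <;> simp [φ, hx]
    have hφint : ∀ μ : Measure S, ∫ x, φ x ∂μ = μ.real A := fun μ => integral_indicator_one hA
    have hφi : ∀ μ : Measure S, IsProbabilityMeasure μ → Integrable φ μ := fun μ _ =>
      (integrable_const (1 : ℝ)).mono' hφ.aestronglyMeasurable (Filter.Eventually.of_forall hφ1)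
    have hψ1 : ∀ x, |∫ y, φ y ∂κ x| ≤ 1 := fun x => by
      rw [hφint, abs_of_nonneg measureReal_nonneg]
      exact measureReal_le_one
    have h1 := hν _ (measurable_integral_kernel (κ := κ) hφ) hψ1
    -- Invariance: the same sequence converges to the integral of `κ φ` and, as a shift of the orbit
    -- by one step, to the integral of `φ`.
    have h2 : (fun n : ℕ => ∫ x, ∫ y, φ y ∂κ x ∂(κ ^ n) z₀)
        = fun n : ℕ => ∫ y, φ y ∂(κ ^ (1 + n)) z₀ := by
      funext n
      rw [integral_pow_add 1 n z₀ (hφi _ inferInstance), pow_one]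
    rw [h2] at h1
    have h3 := (hν φ hφ hφ1).comp (Filter.tendsto_atTop_mono (fun n : ℕ => Nat.le_add_left n 1)
      Filter.tendsto_id)
    have h4 := tendsto_nhds_unique h1 h3
    rw [← hφint, ← hφint, ← h4]
    exact integral_bind_kernel (hφi _ inferInstance)
  have hinvn : ∀ n : ℕ, ν.bind (κ ^ n) = ν := by
    intro n
    induction n with
    | zero => exact Measure.bind_dirac
    | succ n ih =>
      have h1 : κ ^ (n + 1) = (κ ^ n) ∘ₖ κ := pow_succ κ n
      rw [h1, ← Measure.comp_assoc, hinv, ih]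
  refine ⟨ν, hνP, hinv, hVν, C / b * (2 + ∫ x, V x ∂ν), ρ, ?_, hρ, hρ1, ?_⟩
  · have : 0 ≤ ∫ x, V x ∂ν := integral_nonneg hV
    positivity
  intro φ D hφ hD n z
  have hD0 : 0 ≤ D := by
    have h1 := (abs_nonneg _).trans (hD z)
    exact nonneg_of_mul_nonneg_left h1 (by linarith [hV z])
  have hφosc : OscBound V b (D / b) φ := fun x y => by
    have h1 := abs_sub_le (φ x) 0 (φ y)
    rw [sub_zero, zero_sub, abs_neg] at h1
    have h2 : D / b * (2 + b * V x + b * V y) = D * (2 / b) + D * (V x + V y) := by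
      field_simp
      ring
    have h3 : 2 ≤ 2 / b := by rw [le_div_iff₀ hb]; linarith
    have h4 := mul_le_mul_of_nonneg_left h3 hD0
    rw [h2]
    linarith [hD x, hD y]
  have hφν : Integrable φ ν := hφosc.integrable hφ hVν
  refine ⟨hφosc.integrable hφ ((hpow n).2 z).1, ?_⟩
  have h1 : ∫ y, φ y ∂ν = ∫ x, ∫ y, φ y ∂(κ ^ n) x ∂ν := by
    have hi : Integrable φ (ν.bind ⇑(κ ^ n)) := by rwa [hinvn n]
    have h2 := integral_bind_kernel hi
    rwa [hinvn n] at h2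
  rw [h1]
  refine (hdiff φ (D / b) hφ (by positivity) hφosc n z ν hVν).trans ?_
  have hν0 : 0 ≤ ∫ x, V x ∂ν := integral_nonneg hV
  have h2 : (2 + b * V z) + b * ∫ x, V x ∂ν ≤ (2 + ∫ x, V x ∂ν) * (1 + V z) := by
    have h3 : b * V z ≤ V z := mul_le_of_le_one_left (hV z) hb1
    have h4 : b * ∫ x, V x ∂ν ≤ ∫ x, V x ∂ν := mul_le_of_le_one_left hν0 hb1
    nlinarith [hV z, mul_nonneg hν0 (hV z)]
  calc C * ρ ^ n * (D / b) * (2 + b * V z) + C * ρ ^ n * (D / b) * b * ∫ x, V x ∂ν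
      = C * ρ ^ n * (D / b) * ((2 + b * V z) + b * ∫ x, V x ∂ν) := by ring
    _ ≤ C * ρ ^ n * (D / b) * ((2 + ∫ x, V x ∂ν) * (1 + V z)) := by gcongr
    _ = C / b * (2 + ∫ x, V x ∂ν) * ρ ^ n * D * (1 + V z) := by ring

end Ergodic

/-! ### The backward Euler map in complex coordinates and its inverse. -/

namespace HopfBEM

open ComplexConjugate

/-- The identification of the Euclidean plane with `ℂ`. -/
noncomputable def planeC : E2 ≃ₗᵢ[ℝ] ℂ := Complex.orthonormalBasisOneI.repr.symm

theorem planeC_apply (v : E2) : planeC v = ⟨v 0, v 1⟩ := by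
  have h : v = Complex.orthonormalBasisOneI.repr ⟨v 0, v 1⟩ := by
    ext i
    fin_cases i <;> simp [Complex.orthonormalBasisOneI_repr_apply]
  rw [planeC, LinearIsometryEquiv.symm_apply_eq]
  exact h

theorem planeC_symm_apply (z : ℂ) : planeC.symm z = !₂[z.re, z.im] := by
  rw [LinearIsometryEquiv.symm_apply_eq, planeC_apply]
  simp

theorem norm_sq_eq (v : E2) : ‖v‖ ^ 2 = v 0 ^ 2 + v 1 ^ 2 := by
  rw [EuclideanSpace.norm_sq_eq]
  simp [Fin.sum_univ_two]

/-- The complex number by which the backward Euler map multiplies a point of squared norm `ρ`. -/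
noncomputable def multiplier (a b α β τ ρ : ℝ) : ℂ :=
  ⟨1 - τ * α + τ * a * ρ, -(τ * β + τ * b * ρ)⟩

/-- The two matrices of the drift are multiplication by `α + iβ` and by `-a + ib`. -/
theorem planeC_sub_smul_drift (a b α β τ : ℝ) (Y : E2) :
    planeC (Y - τ • drift a b α β Y) = multiplier a b α β τ (‖Y‖ ^ 2) * planeC Y := by
  rw [planeC_apply, planeC_apply, norm_sq_eq]
  apply Complex.ext <;>
  · simp [multiplier, drift, linPart, cubPart, norm_sq_eq, Matrix.mulVec, dotProduct, Fin.sum_univ_two]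
    ring

theorem normSq_multiplier (a b α β τ ρ : ℝ) : Complex.normSq (multiplier a b α β τ ρ)
    = (1 - τ * α + τ * a * ρ) ^ 2 + (τ * β + τ * b * ρ) ^ 2 := by
  rw [Complex.normSq_apply, multiplier]
  ring

/-- The squared norm of the image under the backward Euler map of a point of squared norm `ρ`. -/
noncomputable def radial (a b α β τ ρ : ℝ) : ℝ :=
  ρ * ((1 - τ * α + τ * a * ρ) ^ 2 + (τ * β + τ * b * ρ) ^ 2)

theorem norm_sq_sub_smul_drift (a b α β τ : ℝ) (Y : E2) :
    ‖Y - τ • drift a b α β Y‖ ^ 2 = radial a b α β τ (‖Y‖ ^ 2) := by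
  rw [← planeC.norm_map, planeC_sub_smul_drift, norm_mul, mul_pow, planeC.norm_map,
    ← Complex.normSq_eq_norm_sq, normSq_multiplier, radial]
  ring

/-- The conditions on the parameters that the analysis of the scheme uses. -/
structure Admissible (a α β τ : ℝ) : Prop where
  a_pos : 0 < a
  tau_pos : 0 < τ
  alpha_le : |τ * α| ≤ 1 / 4
  beta_le : |τ * β| ≤ 1 / 12

theorem Admissible.of_lt {a b α β τ : ℝ} (ha : 0 < a) (hτ : 0 < τ)
    (h : τ < min (min (a / (1 + 4 * b * |β|)) (1 / (1 + 12 * |β|)))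
      (min (1 / (1 + 4 * |α|)) (4 / a))) : Admissible a α β τ := by
  have h1 : τ < 1 / (1 + 12 * |β|) := h.trans_le ((min_le_left _ _).trans (min_le_right _ _))
  have h2 : τ < 1 / (1 + 4 * |α|) := h.trans_le ((min_le_right _ _).trans (min_le_left _ _))
  rw [lt_div_iff₀ (by positivity)] at h1 h2
  refine ⟨ha, hτ, ?_, ?_⟩
  · rw [abs_mul, abs_of_pos hτ]; linarith
  · rw [abs_mul, abs_of_pos hτ]; linarith

variable {a b α β τ : ℝ}

theorem Admissible.re_le (h : Admissible a α β τ) (ρ : ℝ) :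
    3 / 4 + τ * a * ρ ≤ 1 - τ * α + τ * a * ρ := by
  have := (abs_le.1 h.alpha_le).2
  linarith

/-- After factoring out `y - x`, only the cross term in `β b` can be negative. Completing the
square, using `x² + xy + y² ≥ 3/4 (x + y)²`, bounds its damage by `(τ β)² / 3`, far below `(1 - τ
α)² ≥ 9/16`. -/
theorem Admissible.radial_strictMonoOn (h : Admissible a α β τ) :
    StrictMonoOn (radial a b α β τ) (Set.Ici 0) := by
  intro x hx y hy hxy
  rw [Set.mem_Ici] at hx hy
  have hτa : 0 < τ * a := mul_pos h.tau_pos h.a_pos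
  have hp := (abs_le.1 h.alpha_le).2
  have hq := h.beta_le
  have hq2 : (τ * β) ^ 2 ≤ (1 / 12) ^ 2 := sq_le_sq.2 (by rwa [abs_of_pos (by norm_num : (0:ℝ) < 1/12)])
  have h1 : radial a b α β τ y - radial a b α β τ x
      = (y - x) * ((1 - τ * α) ^ 2 + 2 * (1 - τ * α) * (τ * a) * (x + y)
        + (τ * a) ^ 2 * (x ^ 2 + x * y + y ^ 2)
        + ((τ * β) ^ 2 + 2 * (τ * β) * (τ * b) * (x + y)
        + (τ * b) ^ 2 * (x ^ 2 + x * y + y ^ 2))) := by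
    unfold radial
    ring
  have h2 : 0 ≤ (τ * a) ^ 2 * (x ^ 2 + x * y + y ^ 2) := by positivity
  have h3 : 0 ≤ 2 * (1 - τ * α) * (τ * a) * (x + y) :=
    mul_nonneg (mul_nonneg (by linarith) hτa.le) (by linarith)
  have h4 : (9 / 16 : ℝ) ≤ (1 - τ * α) ^ 2 := by nlinarith
  have h5 : -((τ * β) ^ 2) / 3 ≤ (τ * β) ^ 2 + 2 * (τ * β) * (τ * b) * (x + y)
        + (τ * b) ^ 2 * (x ^ 2 + x * y + y ^ 2) := by
    nlinarith [sq_nonneg (4 * (τ * β) + 3 * (τ * b) * (x + y)), sq_nonneg ((τ * b) * (x - y))]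
  have h6 : 0 < (y - x) * ((1 - τ * α) ^ 2 + 2 * (1 - τ * α) * (τ * a) * (x + y)
        + (τ * a) ^ 2 * (x ^ 2 + x * y + y ^ 2)
        + ((τ * β) ^ 2 + 2 * (τ * β) * (τ * b) * (x + y)
        + (τ * b) ^ 2 * (x ^ 2 + x * y + y ^ 2))) :=
    mul_pos (by linarith) (by nlinarith)
  linarith

theorem Admissible.multiplier_ne_zero (h : Admissible a α β τ) {ρ : ℝ} (hρ : 0 ≤ ρ) :
    multiplier a b α β τ ρ ≠ 0 := by
  intro h0
  have h1 := congrArg Complex.re h0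
  have h2 := h.re_le ρ
  have := mul_nonneg (mul_pos h.tau_pos h.a_pos).le hρ
  simp only [multiplier, Complex.zero_re] at h1
  linarith

theorem Admissible.injective (h : Admissible a α β τ) :
    Function.Injective fun Y : E2 => Y - τ • drift a b α β Y := by
  intro Y Z hYZ
  simp only at hYZ
  have h1 : radial a b α β τ (‖Y‖ ^ 2) = radial a b α β τ (‖Z‖ ^ 2) := by
    rw [← norm_sq_sub_smul_drift, ← norm_sq_sub_smul_drift, hYZ]
  have h2 : ‖Y‖ ^ 2 = ‖Z‖ ^ 2 :=
    h.radial_strictMonoOn.injOn (Set.mem_Ici.2 (sq_nonneg _)) (Set.mem_Ici.2 (sq_nonneg _)) h1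
  have h3 := congrArg planeC hYZ
  rw [planeC_sub_smul_drift, planeC_sub_smul_drift, h2] at h3
  exact planeC.injective (mul_left_cancel₀ (h.multiplier_ne_zero (sq_nonneg _)) h3)

theorem Admissible.le_radial (h : Admissible a α β τ) {ρ : ℝ} (hρ : 0 ≤ ρ) :
    ρ * (3 / 4 + τ * a * ρ) ^ 2 ≤ radial a b α β τ ρ := by
  have h1 := h.re_le ρ
  have h2 := mul_nonneg (mul_pos h.tau_pos h.a_pos).le hρ
  refine mul_le_mul_of_nonneg_left ?_ hρ
  have h3 : (3 / 4 + τ * a * ρ) ^ 2 ≤ (1 - τ * α + τ * a * ρ) ^ 2 :=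
    pow_le_pow_left₀ (by linarith) h1 2
  nlinarith [sq_nonneg (τ * β + τ * b * ρ)]

theorem Admissible.exists_radial_eq (h : Admissible a α β τ) {r : ℝ} (hr : 0 ≤ r) :
    ∃ ρ, 0 ≤ ρ ∧ radial a b α β τ ρ = r := by
  have hc : Continuous (radial a b α β τ) := by unfold radial; fun_prop
  have h1 : r ∈ Set.Icc (radial a b α β τ 0) (radial a b α β τ (2 * r)) := by
    refine ⟨by simpa [radial] using hr, ?_⟩
    refine le_trans ?_ (h.le_radial (by linarith))
    have h2 := mul_nonneg (mul_pos h.tau_pos h.a_pos).le (by linarith : 0 ≤ 2 * r)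
    have h3 : (9 / 16 : ℝ) ≤ (3 / 4 + τ * a * (2 * r)) ^ 2 := by nlinarith
    nlinarith
  obtain ⟨ρ, hρ, hρ'⟩ := intermediate_value_Icc (by linarith) hc.continuousOn h1
  exact ⟨ρ, hρ.1, hρ'⟩

/-- For surjectivity, the modulus of the preimage is found by the intermediate value theorem; the
multiplier is then a known nonzero number and can be divided out. -/
theorem Admissible.bijective (h : Admissible a α β τ) :
    Function.Bijective fun Y : E2 => Y - τ • drift a b α β Y := by
  refine ⟨h.injective, fun Z => ?_⟩
  obtain ⟨ρ, hρ, hρr⟩ := h.exists_radial_eq (b := b) (sq_nonneg ‖Z‖)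
  have hm := h.multiplier_ne_zero (b := b) hρ
  refine ⟨planeC.symm (planeC Z / multiplier a b α β τ ρ), planeC.injective ?_⟩
  have h1 : ‖planeC.symm (planeC Z / multiplier a b α β τ ρ)‖ ^ 2 = ρ := by
    rw [LinearIsometryEquiv.norm_map, norm_div, planeC.norm_map, div_pow, ← hρr,
      ← Complex.normSq_eq_norm_sq, normSq_multiplier, radial,
      mul_div_assoc, div_self, mul_one]
    rw [← normSq_multiplier]
    exact (Complex.normSq_pos.2 hm).ne'
  rw [planeC_sub_smul_drift, h1, LinearIsometryEquiv.apply_symm_apply, mul_div_cancel₀ _ hm]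

theorem Admissible.bemStep_eq_iff (h : Admissible a α β τ) {σ : ℝ} (X w Y : E2) :
    bemStep a b α β σ τ X w = Y ↔ Y - τ • drift a b α β Y = X + σ • w := by
  constructor
  · rintro rfl
    exact Function.invFun_eq (h.bijective.2 _)
  · intro hY
    rw [bemStep, ← hY]
    exact Function.leftInverse_invFun h.injective Y

/-- The inverse of the backward Euler map. -/
noncomputable def resolvent (a b α β τ : ℝ) : E2 → E2 :=
  Function.invFun fun Y : E2 => Y - τ • drift a b α β Y

theorem Admissible.resolvent_eq_iff (h : Admissible a α β τ) (Z Y : E2) :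
    resolvent a b α β τ Z = Y ↔ Y - τ • drift a b α β Y = Z := by
  constructor
  · rintro rfl
    exact Function.invFun_eq (h.bijective.2 _)
  · rintro rfl
    exact Function.leftInverse_invFun h.injective Y

theorem Admissible.resolvent_spec (h : Admissible a α β τ) (Z : E2) :
    resolvent a b α β τ Z - τ • drift a b α β (resolvent a b α β τ Z) = Z :=
  (h.resolvent_eq_iff _ _).1 rfl

theorem continuous_drift : Continuous (drift a b α β) := by
  unfold drift
  have h1 : Continuous (linPart α β).toEuclideanLin := LinearMap.continuous_of_finiteDimensional _
  have h2 : Continuous (cubPart a b).toEuclideanLin := LinearMap.continuous_of_finiteDimensional _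
  fun_prop

theorem Admissible.le_norm_sub_smul_drift (h : Admissible a α β τ) (Y : E2) :
    3 / 4 * ‖Y‖ ≤ ‖Y - τ • drift a b α β Y‖ := by
  refine (pow_le_pow_iff_left₀ (by positivity) (norm_nonneg _) two_ne_zero).1 ?_
  rw [norm_sq_sub_smul_drift]
  refine le_trans ?_ (h.le_radial (sq_nonneg _))
  have h2 := mul_nonneg (mul_pos h.tau_pos h.a_pos).le (sq_nonneg ‖Y‖)
  have h3 : (9 / 16 : ℝ) ≤ (3 / 4 + τ * a * ‖Y‖ ^ 2) ^ 2 := by nlinarith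
  nlinarith [sq_nonneg ‖Y‖]

/-- The backward Euler map is coercive, hence proper and closed; a closed continuous bijection is a
homeomorphism. -/
theorem Admissible.continuous_resolvent (h : Admissible a α β τ) :
    Continuous (resolvent a b α β τ) := by
  have hc : Continuous fun Y : E2 => Y - τ • drift a b α β Y :=
    continuous_id.sub (continuous_drift.const_smul τ)
  have hprop : IsProperMap fun Y : E2 => Y - τ • drift a b α β Y := by
    rw [isProperMap_iff_tendsto_cocompact]
    refine ⟨hc, ?_⟩
    rw [← Metric.cobounded_eq_cocompact, ← comap_norm_atTop, Filter.tendsto_comap_iff]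
    refine Filter.tendsto_atTop_mono h.le_norm_sub_smul_drift ?_
    exact Filter.Tendsto.const_mul_atTop (by norm_num) Filter.tendsto_comap
  let e : E2 ≃ₜ E2 := (Equiv.ofBijective _ h.bijective).toHomeomorphOfContinuousClosed hc
    hprop.isClosedMap
  have he : resolvent a b α β τ = e.symm := by
    funext Z
    rw [h.resolvent_eq_iff]
    exact e.apply_symm_apply Z
  rw [he]
  exact e.symm.continuous

/-- With `ρ = ‖Y‖ ^ 2` and `u = τ a ρ`, `le_radial` gives `‖Z‖² ≥ 3/2 u ρ`, and `3/2 u² ≥ 4 u - 4`.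
The factor 1/4 is small enough to survive the factor 2 lost when the noise is split off. -/
theorem Admissible.norm_sq_resolvent_le (h : Admissible a α β τ) (Z : E2) :
    ‖resolvent a b α β τ Z‖ ^ 2 ≤ ‖Z‖ ^ 2 / 4 + 1 / (τ * a) := by
  set Y := resolvent a b α β τ Z
  have h1 : ‖Z‖ ^ 2 = radial a b α β τ (‖Y‖ ^ 2) := by
    rw [← norm_sq_sub_smul_drift, h.resolvent_spec]
  have hρ := sq_nonneg ‖Y‖
  have hta := mul_pos h.tau_pos h.a_pos
  have h2 := h.le_radial (b := b) hρ
  rw [← h1] at h2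
  set ρ := ‖Y‖ ^ 2
  have h3 : ρ * (3 / 2 * (τ * a * ρ)) ≤ ‖Z‖ ^ 2 := by
    refine le_trans (mul_le_mul_of_nonneg_left ?_ hρ) h2
    nlinarith [sq_nonneg (τ * a * ρ)]
  have h4 : 4 * ρ - 4 / (τ * a) ≤ ρ * (3 / 2 * (τ * a * ρ)) := by
    have h5 : 4 / (τ * a) * (τ * a) = 4 := div_mul_cancel₀ _ hta.ne'
    have h6 : 0 < 4 / (τ * a) := by positivity
    have h7 : τ * a * (4 * ρ - 4 / (τ * a)) ≤ τ * a * (ρ * (3 / 2 * (τ * a * ρ))) := by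
      nlinarith [sq_nonneg (τ * a * ρ - 2), sq_nonneg (τ * a * ρ)]
    exact le_of_mul_le_mul_left h7 hta
  have h8 : 4 / (τ * a) = 4 * (1 / (τ * a)) := by ring
  linarith

end HopfBEM

/-! ### The linearized step and its action on directions. -/

namespace HopfBEM

open ComplexConjugate

variable {a b α β τ : ℝ}

/-- The complex linear part of the implicit matrix at the point `z`. -/
noncomputable def confPart (a b α β τ : ℝ) (z : ℂ) : ℂ := multiplier a b α β τ (2 * ‖z‖ ^ 2)

/-- The complex antilinear part of the implicit matrix at the point `z`. -/
noncomputable def antiPart (a b τ : ℝ) (z : ℂ) : ℂ := ⟨τ * a, -(τ * b)⟩ * z ^ 2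

/-- The differential of `|z|² z` is `U ↦ 2 |z|² U + z² Ū`; this explains the doubled argument in
`confPart` and the square in `antiPart`. -/
theorem planeC_implicitMatrix (Y U : E2) :
    planeC ((implicitMatrix a b α β τ Y).toEuclideanLin U)
      = confPart a b α β τ (planeC Y) * planeC U
        + antiPart a b τ (planeC Y) * conj (planeC U) := by
  rw [implicitMatrix_apply, varDrift, confPart, antiPart, planeC.norm_map, planeC_apply,
    planeC_apply U, planeC_apply Y, norm_sq_eq]
  apply Complex.ext <;>
  · simp [multiplier, linPart, cubPart, Matrix.mulVec, dotProduct,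
      Fin.sum_univ_two, inner, pow_two]
    ring

theorem det_implicitMatrix (Y : E2) : (implicitMatrix a b α β τ Y).det
    = Complex.normSq (confPart a b α β τ (planeC Y))
      - Complex.normSq (antiPart a b τ (planeC Y)) := by
  rw [confPart, antiPart, planeC.norm_map, planeC_apply, implicitMatrix, norm_sq_eq, det_fin_two]
  simp only [Matrix.sub_apply, Matrix.add_apply, Matrix.smul_apply, Matrix.of_apply,
    Matrix.mulVec, dotProduct, Fin.sum_univ_two, linPart, cubPart]
  simp [multiplier, pow_two, Complex.normSq_apply]
  ring

/-- The difference of the two sides contains `q² + 4 q s + 3 s²` with `q = τ β` and `s = τ b ρ`,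
which is at least `-q² / 3`; the term `(1 - τ α)²` dominates it. This makes the determinant positive
and keeps `turnRatio` inside the unit disc. -/
theorem Admissible.normSq_antiPart_lt (h : Admissible a α β τ) (z : ℂ) :
    Complex.normSq (antiPart a b τ z) < Complex.normSq (confPart a b α β τ z) := by
  have e1 : Complex.normSq (antiPart a b τ z)
      = ((τ * a) ^ 2 + (τ * b) ^ 2) * (‖z‖ ^ 2) ^ 2 := by
    rw [antiPart, Complex.normSq_mul, map_pow, Complex.normSq_eq_norm_sq z, Complex.normSq_apply]
    ring
  rw [e1, confPart, normSq_multiplier]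
  have hρ := sq_nonneg ‖z‖
  set ρ := ‖z‖ ^ 2
  have hτa : 0 < τ * a := mul_pos h.tau_pos h.a_pos
  have hp := (abs_le.1 h.alpha_le).2
  have hq2 : (τ * β) ^ 2 ≤ (1 / 12) ^ 2 :=
    sq_le_sq.2 (by rw [abs_of_pos (by norm_num : (0 : ℝ) < 1 / 12)]; exact h.beta_le)
  have h4 : (9 / 16 : ℝ) ≤ (1 - τ * α) ^ 2 := by nlinarith
  have h3 : 0 ≤ (1 - τ * α) * (τ * a * ρ) :=
    mul_nonneg (by linarith) (mul_nonneg hτa.le hρ)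
  nlinarith [sq_nonneg (2 * (τ * β) + 3 * (τ * b * ρ)), sq_nonneg (τ * a * ρ)]

theorem Admissible.isUnit_det (h : Admissible a α β τ) (Y : E2) :
    IsUnit (implicitMatrix a b α β τ Y).det := by
  rw [det_implicitMatrix]
  exact (sub_pos.2 (h.normSq_antiPart_lt _)).ne'.isUnit

theorem inv_implicitMatrix_apply_self (h : Admissible a α β τ) (Y U : E2) :
    ((implicitMatrix a b α β τ Y)⁻¹).toEuclideanLin
      ((implicitMatrix a b α β τ Y).toEuclideanLin U) = U := by
  have h1 := Matrix.nonsing_inv_mul _ (h.isUnit_det (b := b) Y)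
  rw [Matrix.toLpLin_apply, Matrix.toLpLin_apply, WithLp.ofLp_toLp, Matrix.mulVec_mulVec, h1,
    Matrix.one_mulVec, WithLp.toLp_ofLp]

theorem Admissible.planeC_inv_implicitMatrix (h : Admissible a α β τ) (Y V : E2) :
    planeC (((implicitMatrix a b α β τ Y)⁻¹).toEuclideanLin V)
      = (((implicitMatrix a b α β τ Y).det)⁻¹ : ℝ)
        * (conj (confPart a b α β τ (planeC Y)) * planeC V
          - antiPart a b τ (planeC Y) * conj (planeC V)) := by
  have hd : (implicitMatrix a b α β τ Y).det ≠ 0 := (h.isUnit_det Y).ne_zero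
  set d := (implicitMatrix a b α β τ Y).det with hdd
  have hd' : (d : ℂ) ≠ 0 := by exact_mod_cast hd
  set P := confPart a b α β τ (planeC Y)
  set Q := antiPart a b τ (planeC Y)
  have hPQ : (d : ℂ) = P * conj P - Q * conj Q := by
    rw [hdd, det_implicitMatrix, Complex.mul_conj, Complex.mul_conj]
    push_cast
    rfl
  obtain ⟨U, hU⟩ : ∃ U : E2, planeC U = ((d⁻¹ : ℝ) : ℂ) * (conj P * planeC V
      - Q * conj (planeC V)) := planeC.surjective _
  have hV : V = (implicitMatrix a b α β τ Y).toEuclideanLin U := by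
    apply planeC.injective
    rw [planeC_implicitMatrix, hU]
    simp only [map_mul, map_sub, Complex.conj_conj, Complex.conj_ofReal]
    have h1 : P * (((d⁻¹ : ℝ) : ℂ) * (conj P * planeC V - Q * conj (planeC V)))
        + Q * (((d⁻¹ : ℝ) : ℂ) * (P * conj (planeC V) - conj Q * planeC V))
        = ((d⁻¹ : ℝ) : ℂ) * (P * conj P - Q * conj Q) * planeC V := by ring
    rw [h1, ← hPQ]
    push_cast
    rw [inv_mul_cancel₀ hd', one_mul]
  rw [hV, inv_implicitMatrix_apply_self h, ← hV, hU]

theorem lineAngle_eq_of_planeC_eq {v : E2} {r s : ℝ} (hr : 0 < r)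
    (h : planeC v = r * Complex.exp (s * Complex.I)) : lineAngle v = (s : Direction) := by
  have h1 : ((Complex.arg (planeC v) : ℝ) : Real.Angle) = s := by
    rw [h, Complex.exp_mul_I]
    simpa using Complex.arg_mul_cos_add_sin_mul_I_coe_angle hr s
  rw [planeC_apply, Real.Angle.angle_eq_iff_two_pi_dvd_sub] at h1
  obtain ⟨n, hn⟩ := h1
  rw [lineAngle, ← sub_eq_zero, ← AddCircle.coe_sub, AddCircle.coe_eq_zero_iff]
  refine ⟨2 * n, ?_⟩
  push_cast [zsmul_eq_mul]
  linarith

theorem planeC_unitVec (t : ℝ) : planeC (unitVec t) = Complex.exp (t * Complex.I) := by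
  rw [planeC_apply, unitVec]
  apply Complex.ext
  · simp [Complex.exp_ofReal_mul_I_re]
  · simp [Complex.exp_ofReal_mul_I_im]

theorem directionMap_coe (A : Matrix (Fin 2) (Fin 2) ℝ) (t : ℝ) :
    directionMap A (t : Direction) = lineAngle (A.toEuclideanLin (unitVec t)) :=
  (periodic_lineAngle A).lift_coe t

theorem planeC_eq_norm_mul_exp_arg (v : E2) :
    planeC v = ‖v‖ * Complex.exp (Complex.arg (planeC v) * Complex.I) := by
  rw [← planeC.norm_map, Complex.norm_mul_exp_arg_mul_I]

theorem lineAngle_eq_coe_arg (v : E2) :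
    lineAngle v = ((Complex.arg (planeC v) : ℝ) : Direction) := by
  rw [planeC_apply, lineAngle]

theorem lineAngle_smul {r : ℝ} (hr : 0 < r) (v : E2) : lineAngle (r • v) = lineAngle v := by
  rw [lineAngle_eq_coe_arg, lineAngle_eq_coe_arg, map_smul, Complex.real_smul,
    Complex.arg_real_mul _ hr]

theorem directionMap_lineAngle (A : Matrix (Fin 2) (Fin 2) ℝ) {v : E2} (hv : v ≠ 0) :
    directionMap A (lineAngle v) = lineAngle (A.toEuclideanLin v) := by
  have h1 : v = ‖v‖ • unitVec (Complex.arg (planeC v)) := by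
    apply planeC.injective
    rw [map_smul, planeC_unitVec, Complex.real_smul]
    exact planeC_eq_norm_mul_exp_arg v
  rw [lineAngle_eq_coe_arg, directionMap_coe]
  conv_rhs => rw [h1, map_smul, lineAngle_smul (norm_pos_iff.2 hv)]

/-- The quotient that governs how much the linearized step turns different directions. -/
noncomputable def turnRatio (a b α β τ : ℝ) (z : ℂ) : ℂ :=
  -antiPart a b τ z / conj (confPart a b α β τ z)

/-- The angle by which the inverse of the implicit matrix at `z` turns the direction `t`. -/
noncomputable def turnAngle (a b α β τ : ℝ) (z : ℂ) (t : ℝ) : ℝ :=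
  Complex.arg (conj (confPart a b α β τ z))
    + Complex.arg (1 + turnRatio a b α β τ z * Complex.exp (-(2 * t) * Complex.I))

theorem Admissible.confPart_ne_zero (h : Admissible a α β τ) (z : ℂ) :
    confPart a b α β τ z ≠ 0 :=
  h.multiplier_ne_zero (by positivity)

theorem Admissible.norm_turnRatio_lt_one (h : Admissible a α β τ) (z : ℂ) :
    ‖turnRatio a b α β τ z‖ < 1 := by
  have h1 := h.normSq_antiPart_lt (b := b) z
  have h2 := h.confPart_ne_zero (b := b) z
  rw [turnRatio, norm_div, norm_neg, Complex.norm_conj, div_lt_one (norm_pos_iff.2 h2)]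
  rw [Complex.normSq_eq_norm_sq, Complex.normSq_eq_norm_sq] at h1
  exact lt_of_pow_lt_pow_left₀ 2 (norm_nonneg _) h1

theorem re_one_add_pos {w : ℂ} (hw : ‖w‖ < 1) : 0 < (1 + w).re := by
  have := Complex.abs_re_le_norm w
  have := (abs_le.1 this).1
  simp only [Complex.add_re, Complex.one_re]
  linarith

theorem norm_mul_exp_real_mul_I (w : ℂ) (t : ℝ) :
    ‖w * Complex.exp (t * Complex.I)‖ = ‖w‖ := by
  rw [norm_mul, Complex.norm_exp_ofReal_mul_I, mul_one]

/-- Up to a positive factor the inverse sends `exp (it)` to `P̄ exp (it) - Q exp (-it) = P̄ (1 + k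
exp (-2it)) exp (it)`. As `|k| < 1`, the middle factor lies in the right half plane, away from the
cut of `arg`. -/
theorem Admissible.directionMap_inv_coe (h : Admissible a α β τ) (Y : E2) (t : ℝ) :
    directionMap (implicitMatrix a b α β τ Y)⁻¹ (t : Direction)
      = ((t + turnAngle a b α β τ (planeC Y) t : ℝ) : Direction) := by
  have hd : 0 < (implicitMatrix a b α β τ Y).det := by
    rw [det_implicitMatrix]
    exact sub_pos.2 (h.normSq_antiPart_lt _)
  rw [directionMap_coe]
  set z := planeC Y
  have hP := h.confPart_ne_zero (b := b) z
  have hP' : conj (confPart a b α β τ z) ≠ 0 := by simpa using hP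
  have hk : ‖turnRatio a b α β τ z * Complex.exp (-(2 * t) * Complex.I)‖ < 1 := by
    have h1 := norm_mul_exp_real_mul_I (turnRatio a b α β τ z) (-(2 * t))
    push_cast at h1
    rw [h1]
    exact h.norm_turnRatio_lt_one z
  have hw : 1 + turnRatio a b α β τ z * Complex.exp (-(2 * t) * Complex.I) ≠ 0 := by
    intro h0
    have h1 := re_one_add_pos hk
    rw [h0] at h1
    simp at h1
  refine lineAngle_eq_of_planeC_eq (r := ((implicitMatrix a b α β τ Y).det)⁻¹ *
    (‖conj (confPart a b α β τ z)‖
      * ‖1 + turnRatio a b α β τ z * Complex.exp (-(2 * t) * Complex.I)‖)) ?_ ?_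
  · have := norm_pos_iff.2 hP'
    have := norm_pos_iff.2 hw
    positivity
  · rw [h.planeC_inv_implicitMatrix, planeC_unitVec]
    have e1 := Complex.norm_mul_exp_arg_mul_I (conj (confPart a b α β τ z))
    have e2 := Complex.norm_mul_exp_arg_mul_I
      (1 + turnRatio a b α β τ z * Complex.exp (-(2 * t) * Complex.I))
    have e3 : conj (Complex.exp (t * Complex.I)) = Complex.exp (t * Complex.I)
        * Complex.exp (-(2 * t) * Complex.I) := by
      rw [← Complex.exp_conj, ← Complex.exp_add]
      congr 1
      simp
      ring
    have e4 : conj (confPart a b α β τ z) * Complex.exp (t * Complex.I)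
        - antiPart a b τ z * conj (Complex.exp (t * Complex.I))
        = conj (confPart a b α β τ z)
          * (1 + turnRatio a b α β τ z * Complex.exp (-(2 * t) * Complex.I))
          * Complex.exp (t * Complex.I) := by
      rw [e3, turnRatio]
      field_simp
      ring
    rw [e4, turnAngle]
    conv_lhs => rw [← e1, ← e2]
    push_cast
    rw [show (((t : ℂ) + (Complex.arg (conj (confPart a b α β τ z)) +
        Complex.arg (1 + turnRatio a b α β τ z * Complex.exp (-(2 * t) * Complex.I)))) * Complex.I)
      = t * Complex.I + (Complex.arg (conj (confPart a b α β τ z)) * Complex.I +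
        Complex.arg (1 + turnRatio a b α β τ z * Complex.exp (-(2 * t) * Complex.I))
          * Complex.I) by ring, Complex.exp_add, Complex.exp_add]
    ring

end HopfBEM

/-! ### Lower bounds for images and convolutions of Lebesgue measure on intervals. -/

/-- The image of Lebesgue measure under a Lipschitz function dominates a multiple of Lebesgue
measure on every interval between two values. -/
theorem setLIntegral_le_mul_setLIntegral_comp_of_lipschitzWith {h : ℝ → ℝ} {K : ℝ≥0}
    (hh : LipschitzWith K h) {I : Set ℝ} (hI : IsPreconnected I)
    {x y u v : ℝ} (hx : x ∈ I) (hy : y ∈ I) (hxu : h x ≤ u) (hvy : v ≤ h y)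
    {F : ℝ → ENNReal} (hF : Measurable F) :
    ∫⁻ r in Set.Icc u v, F r ≤ K * ∫⁻ θ in I, F (h θ) := by
  have hhm : Measurable h := hh.continuous.measurable
  have hle : volume.restrict (Set.Icc u v) ≤ (K : ENNReal) • (volume.restrict I).map h := by
    refine Measure.le_iff.2 fun A hA => ?_
    rw [Measure.restrict_apply hA, Measure.smul_apply, Measure.map_apply hhm hA,
      Measure.restrict_apply (hhm hA), smul_eq_mul]
    -- Every value in the interval is attained on `I`, so `A` is covered by an image.
    -- One-dimensional Hausdorff measure is Lebesgue measure and grows at most by the factor `K`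
    -- under `h`, so no injectivity is needed.
    have h1 : A ∩ Set.Icc u v ⊆ h '' (h ⁻¹' A ∩ I) := by
      rintro r ⟨hrA, hr⟩
      obtain ⟨θ, hθ, rfl⟩ := hI.intermediate_value hx hy hh.continuous.continuousOn
        (⟨hxu.trans hr.1, hr.2.trans hvy⟩ : r ∈ Set.Icc (h x) (h y))
      exact ⟨θ, ⟨hrA, hθ⟩, rfl⟩
    refine (measure_mono h1).trans ?_
    have h2 := hh.hausdorffMeasure_image_le zero_le_one (h ⁻¹' A ∩ I)
    rwa [hausdorffMeasure_real, ENNReal.rpow_one] at h2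
  calc ∫⁻ r in Set.Icc u v, F r ≤ ∫⁻ r, F r ∂((K : ENNReal) • (volume.restrict I).map h) :=
        lintegral_mono' hle le_rfl
    _ = K * ∫⁻ θ in I, F (h θ) := by
        rw [lintegral_smul_measure, lintegral_map hF hhm, smul_eq_mul]

theorem Function.Periodic.setLIntegral_Ioc_eq {f : ℝ → ENNReal} {T : ℝ} (hT : 0 < T)
    (hf : Function.Periodic f T) (x y : ℝ) :
    ∫⁻ r in Set.Ioc x (x + T), f r = ∫⁻ r in Set.Ioc y (y + T), f r := by
  have : Fact (0 < T) := ⟨hT⟩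
  have h1 := AddCircle.lintegral_preimage T x hf.lift
  have h2 := AddCircle.lintegral_preimage T y hf.lift
  simp only [hf.lift_coe] at h1 h2
  rw [h1, h2]

/-- Convolution of two multiples of Lebesgue measure on intervals. -/
theorem mul_setLIntegral_Icc_le_setLIntegral_setLIntegral_add {F : ℝ → ENNReal} (hF : Measurable F)
    {c c' δ δ' : ℝ} (hδ : 0 < δ) (hδ' : δ ≤ δ') :
    ENNReal.ofReal (δ / 2) *
        ∫⁻ r in Set.Icc (c + c' - (δ' + δ / 2)) (c + c' + (δ' + δ / 2)), F r
      ≤ ∫⁻ u in Set.Icc (c - δ) (c + δ), ∫⁻ v in Set.Icc (c' - δ') (c' + δ'), F (u + v) := by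
  let J : Set ℝ := Set.Icc (c - δ) (c + δ)
  let J' : Set ℝ := Set.Icc (c' - δ') (c' + δ')
  have hm : Measurable fun p : ℝ × ℝ => J'.indicator (fun _ => (1 : ENNReal)) (p.2 - p.1) * F p.2 :=
    ((measurable_const.indicator measurableSet_Icc).comp
      (measurable_snd.sub measurable_fst)).mul (hF.comp measurable_snd)
  have h1 : ∀ u, ∫⁻ v in J', F (u + v)
      = ∫⁻ r, J'.indicator (fun _ => (1 : ENNReal)) (r - u) * F r := by
    intro u
    rw [← lintegral_indicator measurableSet_Icc,
      ← lintegral_add_left_eq_self (fun r => J'.indicator (fun _ => (1 : ENNReal)) (r - u) * F r) u]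
    refine lintegral_congr fun v => ?_
    simp only [add_sub_cancel_left]
    by_cases hv : v ∈ J'
    · rw [Set.indicator_of_mem hv, Set.indicator_of_mem hv, one_mul]
    · rw [Set.indicator_of_notMem hv, Set.indicator_of_notMem hv, zero_mul]
  calc ENNReal.ofReal (δ / 2) *
        ∫⁻ r in Set.Icc (c + c' - (δ' + δ / 2)) (c + c' + (δ' + δ / 2)), F r
      = ∫⁻ r in Set.Icc (c + c' - (δ' + δ / 2)) (c + c' + (δ' + δ / 2)),
          ENNReal.ofReal (δ / 2) * F r := by rw [lintegral_const_mul _ hF]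
    _ ≤ ∫⁻ r in Set.Icc (c + c' - (δ' + δ / 2)) (c + c' + (δ' + δ / 2)),
          ∫⁻ u in J, J'.indicator (fun _ => (1 : ENNReal)) (r - u) * F r := by
        refine setLIntegral_mono' measurableSet_Icc fun r hr => ?_
        have hm' : Measurable fun u => J'.indicator (fun _ => (1 : ENNReal)) (r - u) :=
          (measurable_const.indicator measurableSet_Icc).comp (measurable_const.sub measurable_id)
        rw [lintegral_mul_const _ hm']
        gcongr
        -- The outer quarter of `J` on the side of `r` works: there `r - u` stays in `J'` even when
        -- `r` exceeds the half-width `δ'` by `δ / 2`.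
        obtain ⟨w, hw⟩ : ∃ w, ∀ u ∈ Set.Icc w (w + δ / 2), u ∈ J ∧ r - u ∈ J' := by
          rcases le_total (c + c') r with hr' | hr'
          · refine ⟨c + δ / 2, fun u hu => ⟨⟨?_, ?_⟩, ⟨?_, ?_⟩⟩⟩ <;>
              linarith [hr.1, hr.2, hu.1, hu.2]
          · refine ⟨c - δ, fun u hu => ⟨⟨?_, ?_⟩, ⟨?_, ?_⟩⟩⟩ <;>
              linarith [hr.1, hr.2, hu.1, hu.2]
        calc ENNReal.ofReal (δ / 2) = ∫⁻ u in Set.Icc w (w + δ / 2), 1 := by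
              simp
          _ ≤ ∫⁻ u in Set.Icc w (w + δ / 2),
                J'.indicator (fun _ => (1 : ENNReal)) (r - u) := by
              refine setLIntegral_mono' measurableSet_Icc fun u hu => ?_
              rw [Set.indicator_of_mem (hw u hu).2]
          _ ≤ _ := lintegral_mono_set fun u hu => (hw u hu).1
    _ ≤ ∫⁻ r, ∫⁻ u in J, J'.indicator (fun _ => (1 : ENNReal)) (r - u) * F r :=
        setLIntegral_le_lintegral _ _
    _ = ∫⁻ u in J, ∫⁻ r, J'.indicator (fun _ => (1 : ENNReal)) (r - u) * F r :=
        lintegral_lintegral_swap (hm.comp measurable_swap).aemeasurable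
    _ = ∫⁻ u in J, ∫⁻ v in J', F (u + v) := by simp only [h1]

/-! ### Symmetry, regularity and nonconstancy of the turn angle. -/

namespace HopfBEM

open ComplexConjugate

variable {a b α β τ : ℝ}

/-- `confPart` depends only on `|z|`, while `antiPart` picks up `exp (2iφ)`, which the factor `exp
(-2it)` absorbs. Noise in the angle of the position thereby becomes noise in the direction. -/
theorem turnAngle_mul (z : ℂ) (φ t : ℝ) :
    turnAngle a b α β τ (Complex.exp (φ * Complex.I) * z) t = turnAngle a b α β τ z (t - φ) := by
  have h1 : confPart a b α β τ (Complex.exp (φ * Complex.I) * z) = confPart a b α β τ z := by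
    rw [confPart, confPart, norm_mul, Complex.norm_exp_ofReal_mul_I, one_mul]
  have h2 : antiPart a b τ (Complex.exp (φ * Complex.I) * z)
      = antiPart a b τ z * Complex.exp (2 * φ * Complex.I) := by
    rw [antiPart, antiPart, mul_pow, ← Complex.exp_nat_mul]
    push_cast
    ring_nf
  have h3 : Complex.exp (-(2 * ((t - φ : ℝ) : ℂ)) * Complex.I)
      = Complex.exp (2 * φ * Complex.I) * Complex.exp (-(2 * t) * Complex.I) := by
    rw [← Complex.exp_add]
    congr 1
    push_cast
    ring
  rw [turnAngle, turnAngle, turnRatio, turnRatio, h1, h2, h3]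
  congr 3
  ring

theorem periodic_turnAngle (z : ℂ) : Function.Periodic (turnAngle a b α β τ z) Real.pi := by
  intro t
  have h : Complex.exp (-(2 * ((t + Real.pi : ℝ) : ℂ)) * Complex.I)
      = Complex.exp (-(2 * t) * Complex.I) := by
    rw [Complex.exp_eq_exp_iff_exists_int]
    exact ⟨-1, by push_cast; ring⟩
  rw [turnAngle, turnAngle, h]

theorem continuous_confPart : Continuous (confPart a b α β τ) := by
  have h : confPart a b α β τ = fun z => ((1 - τ * α + τ * a * (2 * ‖z‖ ^ 2) : ℝ) : ℂ)
      + ((-(τ * β + τ * b * (2 * ‖z‖ ^ 2)) : ℝ) : ℂ) * Complex.I := by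
    funext z
    rw [confPart, multiplier, Complex.mk_eq_add_mul_I]
  rw [h]
  fun_prop

theorem continuous_antiPart : Continuous (antiPart a b τ) := by
  unfold antiPart
  fun_prop

theorem Admissible.continuous_turnRatio (h : Admissible a α β τ) :
    Continuous (turnRatio a b α β τ) := by
  unfold turnRatio
  refine continuous_antiPart.neg.div (Complex.continuous_conj.comp continuous_confPart) fun z => ?_
  simpa using h.confPart_ne_zero z

theorem Admissible.norm_turnRatio_mul_exp_lt_one (h : Admissible a α β τ) (z : ℂ) (t : ℝ) :
    ‖turnRatio a b α β τ z * Complex.exp (-(2 * t) * Complex.I)‖ < 1 := by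
  have h1 := norm_mul_exp_real_mul_I (turnRatio a b α β τ z) (-(2 * t))
  push_cast at h1
  rw [h1]
  exact h.norm_turnRatio_lt_one z

theorem Admissible.continuous_turnAngle (h : Admissible a α β τ) :
    Continuous fun p : ℂ × ℝ => turnAngle a b α β τ p.1 p.2 := by
  unfold turnAngle
  have h1 := h.continuous_turnRatio (b := b)
  have h2 := continuous_confPart (a := a) (b := b) (α := α) (β := β) (τ := τ)
  refine Continuous.add ?_ ?_
  · refine continuous_iff_continuousAt.2 fun p => ?_
    refine ContinuousAt.comp (f := fun p : ℂ × ℝ => conj (confPart a b α β τ p.1))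
      (Complex.continuousAt_arg (Or.inl ?_)) (by fun_prop)
    rw [Complex.conj_re, confPart, multiplier]
    have := h.re_le (2 * ‖p.1‖ ^ 2)
    have : 0 ≤ τ * a * (2 * ‖p.1‖ ^ 2) :=
      mul_nonneg (mul_pos h.tau_pos h.a_pos).le (by positivity)
    simp only
    linarith
  · refine continuous_iff_continuousAt.2 fun p => ?_
    refine ContinuousAt.comp (f := fun p : ℂ × ℝ =>
      1 + turnRatio a b α β τ p.1 * Complex.exp (-(2 * p.2) * Complex.I))
      (Complex.continuousAt_arg (Or.inl ?_)) (by fun_prop)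
    exact re_one_add_pos (h.norm_turnRatio_mul_exp_lt_one _ _)

/-- The part depending on `t` is the imaginary part of `log (1 + w exp (-2it))`, whose derivative
has norm at most `2 |w| / (1 - |w|)`. -/
theorem Admissible.lipschitzWith_turnAngle (h : Admissible a α β τ) {z : ℂ} {k : ℝ} (hk : k < 1)
    (hz : ‖turnRatio a b α β τ z‖ ≤ k) :
    LipschitzWith (2 / (1 - k)).toNNReal (turnAngle a b α β τ z) := by
  set w := turnRatio a b α β τ z
  have hk0 : 0 ≤ k := (norm_nonneg _).trans hz
  let f : ℝ → ℂ := fun t => 1 + w * Complex.exp (-(2 * t) * Complex.I)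
  have hf : ∀ t : ℝ, HasDerivAt f (w * (Complex.exp (-(2 * t) * Complex.I)
      * (-(2 * 1) * Complex.I))) t := by
    intro t
    have h1 : HasDerivAt (fun s : ℝ => -(2 * (s : ℂ)) * Complex.I) (-(2 * 1) * Complex.I) t :=
      ((Complex.ofRealCLM.hasDerivAt (x := t)).const_mul 2).neg.mul_const _
    exact (h1.cexp.const_mul w).const_add 1
  have hn : ∀ t : ℝ, ‖w * Complex.exp (-(2 * t) * Complex.I)‖ = ‖w‖ := fun t => by
    have h1 := norm_mul_exp_real_mul_I w (-(2 * t))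
    push_cast at h1
    exact h1
  have hslit : ∀ t, f t ∈ Complex.slitPlane := fun t =>
    Or.inl (re_one_add_pos (h.norm_turnRatio_mul_exp_lt_one z t))
  have hlog : ∀ t : ℝ, HasDerivAt (fun s => Complex.log (f s)) (w * (Complex.exp (-(2 * t) * Complex.I)
      * (-(2 * 1) * Complex.I)) / f t) t := fun t => (hf t).clog_real (hslit t)
  have hL : LipschitzWith (2 / (1 - k)).toNNReal fun s => Complex.log (f s) := by
    refine lipschitzWith_of_nnnorm_deriv_le (fun t => (hlog t).differentiableAt) fun t => ?_
    rw [(hlog t).deriv, ← NNReal.coe_le_coe, coe_nnnorm,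
      Real.coe_toNNReal _ (div_nonneg zero_le_two (by linarith)), ← mul_assoc, norm_div, norm_mul,
      hn]
    have h2 : ‖(-(2 * 1) * Complex.I : ℂ)‖ = 2 := by simp
    have h3 : 1 - k ≤ ‖f t‖ := by
      have h4 := norm_sub_norm_le (1 : ℂ) (-(w * Complex.exp (-(2 * t) * Complex.I)))
      rw [norm_neg, hn, norm_one, sub_neg_eq_add] at h4
      exact le_trans (by linarith) h4
    rw [h2]
    refine div_le_div₀ zero_le_two ?_ (by linarith) h3
    linarith
  refine LipschitzWith.of_dist_le_mul fun s t => ?_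
  have h5 := hL.dist_le_mul s t
  refine le_trans ?_ h5
  rw [Real.dist_eq, Complex.dist_eq, turnAngle, turnAngle]
  have h6 := Complex.abs_im_le_norm (Complex.log (f s) - Complex.log (f t))
  rw [Complex.sub_im, Complex.log_im, Complex.log_im] at h6
  rw [add_sub_add_left_eq_sub]
  exact h6

theorem Admissible.turnRatio_ne_zero (h : Admissible a α β τ) {z : ℂ} (hz : z ≠ 0) :
    turnRatio a b α β τ z ≠ 0 := by
  have h1 : antiPart a b τ z ≠ 0 := by
    refine mul_ne_zero (fun h0 => ?_) (pow_ne_zero 2 hz)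
    have h2 := congrArg Complex.re h0
    exact (mul_pos h.tau_pos h.a_pos).ne' h2
  refine div_ne_zero (neg_ne_zero.2 h1) ?_
  simpa using h.confPart_ne_zero z

/-- At `x = arg w / 2` the perturbation `w exp (-2ix)` is the positive number `‖w‖`, and the second
argument is 0. At `x - π/4` it is `i ‖w‖`, and the argument is positive because `w ≠ 0`. -/
theorem Admissible.exists_turnAngle_lt (h : Admissible a α β τ) {z : ℂ} (hz : z ≠ 0) :
    ∃ x : ℝ, turnAngle a b α β τ z x < turnAngle a b α β τ z (x - Real.pi / 4) := by
  set w := turnRatio a b α β τ z with hw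
  have hw0 : w ≠ 0 := h.turnRatio_ne_zero hz
  refine ⟨Complex.arg w / 2, ?_⟩
  have e1 : w * Complex.exp (-(2 * ((Complex.arg w / 2 : ℝ) : ℂ)) * Complex.I) = (‖w‖ : ℂ) := by
    nth_rewrite 1 [← Complex.norm_mul_exp_arg_mul_I w]
    rw [mul_assoc, ← Complex.exp_add]
    have : (Complex.arg w : ℂ) * Complex.I + -(2 * ((Complex.arg w / 2 : ℝ) : ℂ)) * Complex.I
        = 0 := by
      push_cast
      ring
    rw [this, Complex.exp_zero, mul_one]
  have e2 : w * Complex.exp (-(2 * ((Complex.arg w / 2 - Real.pi / 4 : ℝ) : ℂ)) * Complex.I)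
      = (‖w‖ : ℂ) * Complex.I := by
    have hI : Complex.exp (Real.pi / 2 * Complex.I) = Complex.I := Complex.exp_pi_div_two_mul_I
    rw [← e1, mul_assoc]
    have hI' : ∀ v : ℂ, Complex.exp v * Complex.I = Complex.exp (v + Real.pi / 2 * Complex.I) :=
      fun v => by rw [Complex.exp_add, hI]
    rw [hI']
    congr 2
    push_cast
    ring
  rw [turnAngle, turnAngle, ← hw, e1, e2]
  have h1 : Complex.arg (1 + (‖w‖ : ℂ)) = 0 := by
    rw [Complex.arg_eq_zero_iff]
    constructor
    · simp only [Complex.add_re, Complex.one_re, Complex.ofReal_re]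
      positivity
    · simp
  have h2 : 0 < Complex.arg (1 + (‖w‖ : ℂ) * Complex.I) := by
    refine lt_of_le_of_ne (Complex.arg_nonneg_iff.2 (by simp)) fun h0 => ?_
    have h3 := (Complex.arg_eq_zero_iff.1 h0.symm).2
    simp at h3
    exact hw0 h3
  linarith

end HopfBEM

/-! ### Lower bounds for the noise, and the spread of directions in polar coordinates. -/

/-- Gaussian densities with bounded mean are bounded below on bounded intervals. -/
theorem exists_mul_setLIntegral_le_lintegral_gaussianReal {v : ℝ≥0} (hv : v ≠ 0) (R L : ℝ) :
    ∃ c : ℝ, 0 < c ∧ ∀ μ : ℝ, |μ| ≤ R → ∀ g : ℝ → ENNReal, Measurable g →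
      ENNReal.ofReal c * ∫⁻ x in Set.Icc (-L) L, g x ≤ ∫⁻ x, g x ∂gaussianReal μ v := by
  refine ⟨(√(2 * Real.pi * v))⁻¹ * Real.exp (-(L + R) ^ 2 / (2 * v)), ?_, fun μ hμ g hg => ?_⟩
  · have : (0 : ℝ) < v := by positivity
    have := Real.pi_pos
    positivity
  · rw [gaussianReal_of_var_ne_zero _ hv,
      lintegral_withDensity_eq_lintegral_mul _ (measurable_gaussianPDF _ _) hg,
      ← lintegral_const_mul _ hg]
    refine le_trans ?_ (setLIntegral_le_lintegral (Set.Icc (-L) L) _)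
    refine setLIntegral_mono' measurableSet_Icc fun x hx => ?_
    rw [Pi.mul_apply]
    gcongr
    rw [gaussianPDF, gaussianPDFReal]
    refine ENNReal.ofReal_le_ofReal ?_
    have h1 : (x - μ) ^ 2 ≤ (L + R) ^ 2 := by
      refine sq_le_sq' ?_ ?_ <;> linarith [hx.1, hx.2, (abs_le.1 hμ).1, (abs_le.1 hμ).2]
    gcongr

namespace HopfBEM

variable {a b α β τ σ : ℝ}

instance : IsProbabilityMeasure (noiseLaw τ) :=
  Measure.isProbabilityMeasure_map (WithLp.measurable_toLp 2 _).aemeasurable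

theorem lintegral_noiseLaw {f : E2 → ENNReal} (hf : Measurable f) :
    ∫⁻ w, f w ∂noiseLaw τ = ∫⁻ u, ∫⁻ v, f !₂[u, v] ∂gaussianReal 0 τ.toNNReal
      ∂gaussianReal 0 τ.toNNReal := by
  rw [noiseLaw, lintegral_map hf (WithLp.measurable_toLp 2 _)]
  have h1 := (measurePreserving_finTwoArrow (gaussianReal 0 τ.toNNReal)).symm
  have hm : Measurable fun p : ℝ × ℝ => f !₂[p.1, p.2] := by
    refine hf.comp ((WithLp.measurable_toLp 2 _).comp ?_)
    refine measurable_pi_lambda _ fun i => ?_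
    fin_cases i
    · exact measurable_fst
    · exact measurable_snd
  rw [← lintegral_prod (fun p : ℝ × ℝ => f !₂[p.1, p.2]) hm.aemeasurable,
    ← h1.lintegral_comp (f := fun a => f (WithLp.toLp 2 a)) (hf.comp (WithLp.measurable_toLp 2 _))]
  refine lintegral_congr fun p => ?_
  rfl

theorem measurable_toE2 : Measurable fun p : ℝ × ℝ => (!₂[p.1, p.2] : E2) := by
  refine (WithLp.measurable_toLp 2 _).comp (measurable_pi_lambda _ fun i => ?_)
  fin_cases i
  · exact measurable_fst
  · exact measurable_snd

theorem lintegral_gaussianReal_affine (x : ℝ) {g : ℝ → ENNReal} (hg : Measurable g) :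
    ∫⁻ u, g (x + σ * u) ∂gaussianReal 0 τ.toNNReal
      = ∫⁻ u, g u ∂gaussianReal x (.mk (σ ^ 2) (sq_nonneg σ) * τ.toNNReal) := by
  have h1 := gaussianReal_map_const_mul (μ := 0) (v := τ.toNNReal) σ
  rw [mul_zero] at h1
  have h2 := gaussianReal_map_const_add (μ := 0) (v := .mk (σ ^ 2) (sq_nonneg σ) * τ.toNNReal) x
  rw [zero_add] at h2
  have m1 : Measurable fun u : ℝ => x + u := by fun_prop
  have m2 : Measurable fun u : ℝ => σ * u := by fun_prop
  rw [← h2, ← h1, lintegral_map hg m1, lintegral_map (f := fun u => g (x + u)) (hg.comp m1) m2]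

/-- The law of `x + σ w` dominates a multiple of Lebesgue measure on squares. -/
theorem exists_mul_setLIntegral_le_lintegral_noiseLaw (hσ : 0 < σ) (hτ : 0 < τ) (R L : ℝ) :
    ∃ c : ℝ, 0 < c ∧ ∀ x : E2, ‖x‖ ≤ R → ∀ f : E2 → ENNReal, Measurable f →
      ENNReal.ofReal c * ∫⁻ u in Set.Icc (-L) L, ∫⁻ v in Set.Icc (-L) L, f !₂[u, v]
        ≤ ∫⁻ w, f (x + σ • w) ∂noiseLaw τ := by
  have hv : NNReal.mk (σ ^ 2) (sq_nonneg σ) * τ.toNNReal ≠ 0 := by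
    refine mul_ne_zero (fun h0 => ?_) (Real.toNNReal_pos.2 hτ).ne'
    have := congrArg NNReal.toReal h0
    simp at this
    exact hσ.ne' this
  obtain ⟨c, hc, h⟩ := exists_mul_setLIntegral_le_lintegral_gaussianReal hv R L
  refine ⟨c * c, by positivity, fun x hx f hf => ?_⟩
  have hx0 : |x 0| ≤ R := by
    refine le_trans ?_ hx
    simpa using PiLp.norm_apply_le x 0
  have hx1 : |x 1| ≤ R := by
    refine le_trans ?_ hx
    simpa using PiLp.norm_apply_le x 1
  have hf2 : Measurable fun p : ℝ × ℝ => f !₂[p.1, p.2] := hf.comp measurable_toE2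
  have hmeas : Measurable fun w : E2 => x + σ • w := by fun_prop
  rw [lintegral_noiseLaw (f := fun w => f (x + σ • w)) (hf.comp hmeas)]
  have e1 : ∀ u v : ℝ, x + σ • (!₂[u, v] : E2) = !₂[x 0 + σ * u, x 1 + σ * v] := fun u v => by
    ext i
    fin_cases i <;> simp
  simp only [e1]
  have hf3 : ∀ u : ℝ, Measurable fun v => f !₂[u, v] := fun u => hf2.comp measurable_prodMk_left
  have e2 : ∀ u : ℝ, ∫⁻ v, f !₂[x 0 + σ * u, x 1 + σ * v] ∂gaussianReal 0 τ.toNNReal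
      = ∫⁻ v, f !₂[x 0 + σ * u, v]
        ∂gaussianReal (x 1) (.mk (σ ^ 2) (sq_nonneg σ) * τ.toNNReal) := fun u =>
    lintegral_gaussianReal_affine (x 1) (hf3 (x 0 + σ * u))
  simp only [e2]
  rw [lintegral_gaussianReal_affine (σ := σ) (x 0)
    (g := fun u => ∫⁻ v, f !₂[u, v] ∂gaussianReal (x 1) (.mk (σ ^ 2) (sq_nonneg σ) * τ.toNNReal))
    hf2.lintegral_prod_right']
  refine le_trans ?_ (h (x 0) hx0 _ hf2.lintegral_prod_right')
  rw [ENNReal.ofReal_mul hc.le, mul_assoc]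
  gcongr
  rw [← lintegral_const_mul _ (hf2.lintegral_prod_right' (ν := volume.restrict (Set.Icc (-L) L)))]
  exact lintegral_mono fun u => h (x 1) hx1 _ (hf3 u)

/-- The annulus lies in the square, and the polar Jacobian is at least `s₁` on it. -/
theorem setLIntegral_polar_le {s₁ s₂ L : ℝ} (hs₁ : 0 < s₁) (hL : s₂ ≤ L) {f : E2 → ENNReal}
    (hf : Measurable f) :
    ENNReal.ofReal s₁ * ∫⁻ s in Set.Icc s₁ s₂, ∫⁻ φ in Set.Ioo (-Real.pi) Real.pi,
        f (planeC.symm (Complex.exp (φ * Complex.I) * s))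
      ≤ ∫⁻ u in Set.Icc (-L) L, ∫⁻ v in Set.Icc (-L) L, f !₂[u, v] := by
  have hf2 : Measurable fun p : ℝ × ℝ => f !₂[p.1, p.2] := hf.comp measurable_toE2
  have hS : MeasurableSet (Set.Icc (-L) L ×ˢ Set.Icc (-L) L) :=
    measurableSet_Icc.prod measurableSet_Icc
  have hT : MeasurableSet (Set.Icc s₁ s₂ ×ˢ Set.Ioo (-Real.pi) Real.pi) :=
    measurableSet_Icc.prod measurableSet_Ioo
  have hm : Measurable fun p : ℝ × ℝ => f (planeC.symm (Complex.exp (p.2 * Complex.I) * p.1)) := by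
    refine hf.comp ?_
    have : Continuous fun p : ℝ × ℝ =>
        planeC.symm (Complex.exp (p.2 * Complex.I) * p.1) := by fun_prop
    exact this.measurable
  calc ENNReal.ofReal s₁ * ∫⁻ s in Set.Icc s₁ s₂, ∫⁻ φ in Set.Ioo (-Real.pi) Real.pi,
        f (planeC.symm (Complex.exp (φ * Complex.I) * s))
      = ∫⁻ p in Set.Icc s₁ s₂ ×ˢ Set.Ioo (-Real.pi) Real.pi,
          ENNReal.ofReal s₁ * f (planeC.symm (Complex.exp (p.2 * Complex.I) * p.1)) := by
        rw [lintegral_const_mul _ hm, Measure.volume_eq_prod,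
          ← Measure.prod_restrict, lintegral_prod _ hm.aemeasurable]
    _ ≤ ∫⁻ p in Set.Icc s₁ s₂ ×ˢ Set.Ioo (-Real.pi) Real.pi, ENNReal.ofReal p.1 •
          (Set.Icc (-L) L ×ˢ Set.Icc (-L) L).indicator (fun p : ℝ × ℝ => f !₂[p.1, p.2])
            (polarCoord.symm p) := by
        refine setLIntegral_mono' hT fun p hp => ?_
        have hp1 : |p.1| ≤ L := by
          rw [abs_of_nonneg (hs₁.le.trans hp.1.1)]
          exact hp.1.2.trans hL
        rw [polarCoord_symm_apply, Set.indicator_of_mem, smul_eq_mul]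
        · have e1 : planeC.symm (Complex.exp (p.2 * Complex.I) * p.1)
              = !₂[p.1 * Real.cos p.2, p.1 * Real.sin p.2] := by
            rw [planeC_symm_apply, Complex.re_mul_ofReal, Complex.im_mul_ofReal,
              Complex.exp_ofReal_mul_I_re, Complex.exp_ofReal_mul_I_im, mul_comm p.1, mul_comm p.1]
          rw [e1]
          gcongr
          exact hp.1.1
        · refine ⟨abs_le.1 ?_, abs_le.1 ?_⟩
          · rw [abs_mul]
            exact (mul_le_of_le_one_right (abs_nonneg _) (Real.abs_cos_le_one _)).trans hp1
          · rw [abs_mul]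
            exact (mul_le_of_le_one_right (abs_nonneg _) (Real.abs_sin_le_one _)).trans hp1
    _ ≤ ∫⁻ p in polarCoord.target, ENNReal.ofReal p.1 •
          (Set.Icc (-L) L ×ˢ Set.Icc (-L) L).indicator (fun p : ℝ × ℝ => f !₂[p.1, p.2])
            (polarCoord.symm p) := by
        refine lintegral_mono_set fun p hp => ?_
        rw [polarCoord_target]
        exact ⟨hs₁.trans_le hp.1.1, hp.2⟩
    _ = ∫⁻ p, (Set.Icc (-L) L ×ˢ Set.Icc (-L) L).indicator
          (fun p : ℝ × ℝ => f !₂[p.1, p.2]) p := lintegral_comp_polarCoord_symm _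
    _ = ∫⁻ u in Set.Icc (-L) L, ∫⁻ v in Set.Icc (-L) L, f !₂[u, v] := by
        rw [lintegral_indicator hS, Measure.volume_eq_prod, ← Measure.prod_restrict,
          lintegral_prod _ hf2.aemeasurable]

/-- The position reached from a point at distance `s` from the origin on the positive axis. -/
noncomputable def radialPoint (a b α β τ s : ℝ) : ℂ :=
  planeC (resolvent a b α β τ (planeC.symm (s : ℂ)))

/-- The multiplier depends only on the modulus, so the backward Euler map and its inverse commute
with rotations. -/
theorem Admissible.planeC_resolvent_polar (h : Admissible a α β τ) (φ s : ℝ) :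
    planeC (resolvent a b α β τ (planeC.symm (Complex.exp (φ * Complex.I) * s)))
      = Complex.exp (φ * Complex.I) * radialPoint a b α β τ s := by
  rw [← LinearIsometryEquiv.eq_symm_apply, h.resolvent_eq_iff]
  apply planeC.injective
  rw [planeC_sub_smul_drift]
  simp only [LinearIsometryEquiv.apply_symm_apply, LinearIsometryEquiv.norm_map]
  rw [norm_mul, Complex.norm_exp_ofReal_mul_I, one_mul, mul_left_comm]
  congr 1
  have h1 := congrArg planeC (h.resolvent_spec (b := b) (planeC.symm (s : ℂ)))
  rw [planeC_sub_smul_drift, LinearIsometryEquiv.apply_symm_apply] at h1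
  rw [radialPoint, planeC.norm_map]
  exact h1

theorem Admissible.continuous_radialPoint (h : Admissible a α β τ) :
    Continuous (radialPoint a b α β τ) := by
  unfold radialPoint
  have := h.continuous_resolvent (b := b)
  fun_prop

theorem Admissible.radialPoint_ne_zero (h : Admissible a α β τ) {s : ℝ} (hs : s ≠ 0) :
    radialPoint a b α β τ s ≠ 0 := by
  intro h0
  have h1 := congrArg planeC (h.resolvent_spec (b := b) (planeC.symm (s : ℂ)))
  rw [planeC_sub_smul_drift, LinearIsometryEquiv.apply_symm_apply] at h1
  rw [radialPoint] at h0
  rw [h0, mul_zero] at h1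
  exact hs (by exact_mod_cast h1.symm)

/-- At radius 1 the turn angle takes two distinct values. By continuity in the radius, one interval
between them and one Lipschitz constant remain valid for all radii near 1. -/
theorem Admissible.exists_setLIntegral_le_turnAngle (h : Admissible a α β τ) :
    ∃ s₁ s₂ c δ θ₀ : ℝ, ∃ K : ℝ≥0, 0 < s₁ ∧ s₁ < s₂ ∧ 0 < δ ∧ 0 < K ∧ ∀ s ∈ Set.Icc s₁ s₂,
      ∀ F : ℝ → ENNReal, Measurable F → ∫⁻ u in Set.Icc (c - δ) (c + δ), F u
        ≤ K * ∫⁻ θ in Set.Ico θ₀ (θ₀ + 2 * Real.pi),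
          F (turnAngle a b α β τ (radialPoint a b α β τ s) θ) := by
  obtain ⟨x, hx⟩ := h.exists_turnAngle_lt (h.radialPoint_ne_zero (b := b) one_ne_zero)
  have hrp := h.continuous_radialPoint (b := b)
  have hcont : ∀ y : ℝ, Continuous fun s : ℝ =>
      turnAngle a b α β τ (radialPoint a b α β τ s) y := fun y =>
    h.continuous_turnAngle.comp (f := fun s : ℝ => (radialPoint a b α β τ s, y))
      (hrp.prodMk continuous_const)
  obtain ⟨lo, hlo⟩ : ∃ lo : ℝ → ℝ, lo = fun s => turnAngle a b α β τ (radialPoint a b α β τ s) x :=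
    ⟨_, rfl⟩
  obtain ⟨hi, hhi⟩ : ∃ hi : ℝ → ℝ, hi = fun s =>
      turnAngle a b α β τ (radialPoint a b α β τ s) (x - Real.pi / 4) := ⟨_, rfl⟩
  have hlo_hi : lo 1 < hi 1 := by rw [hlo, hhi]; exact hx
  have hloc : Continuous lo := hlo ▸ hcont x
  have hhic : Continuous hi := hhi ▸ hcont _
  obtain ⟨c, hc⟩ : ∃ c, c = (lo 1 + hi 1) / 2 := ⟨_, rfl⟩
  obtain ⟨δ, hδ'⟩ : ∃ δ, δ = (hi 1 - lo 1) / 4 := ⟨_, rfl⟩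
  have hδ : 0 < δ := by linarith
  obtain ⟨k, hk'⟩ : ∃ k, k = (1 + ‖turnRatio a b α β τ (radialPoint a b α β τ 1)‖) / 2 :=
    ⟨_, rfl⟩
  have hk1 := h.norm_turnRatio_lt_one (b := b) (radialPoint a b α β τ 1)
  have hk : k < 1 := by linarith
  have hkc : Continuous fun s => ‖turnRatio a b α β τ (radialPoint a b α β τ s)‖ :=
    (h.continuous_turnRatio.comp hrp).norm
  have ev1 : ∀ᶠ s in nhds (1 : ℝ), lo s < c - δ :=
    hloc.continuousAt.eventually_lt_const (by linarith)
  have ev2 : ∀ᶠ s in nhds (1 : ℝ), c + δ < hi s :=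
    hhic.continuousAt.eventually_const_lt (by linarith)
  have ev3 : ∀ᶠ s in nhds (1 : ℝ), ‖turnRatio a b α β τ (radialPoint a b α β τ s)‖ < k :=
    hkc.continuousAt.eventually_lt_const (by linarith)
  obtain ⟨ε, hε, hball⟩ := Metric.eventually_nhds_iff.1 (ev1.and (ev2.and ev3))
  have hm : 0 < min ε 1 := lt_min hε one_pos
  -- The angular window starts at `x - π/2` so that both `x` and `x - π/4` lie in it. The cap by 1
  -- keeps the radii positive.
  refine ⟨1 - min ε 1 / 2, 1 + min ε 1 / 2, c, δ, x - Real.pi / 2, (2 / (1 - k)).toNNReal,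
    by linarith [min_le_right ε 1], by linarith, hδ, ?_, fun s hs F hF => ?_⟩
  · rw [Real.toNNReal_pos]
    exact div_pos two_pos (by linarith)
  have hs' : dist s 1 < ε := by
    rw [Real.dist_eq, abs_lt]
    constructor <;> linarith [hs.1, hs.2, min_le_left ε 1]
  obtain ⟨e1, e2, e3⟩ := hball hs'
  have hπ := Real.pi_pos
  rw [hlo] at e1
  rw [hhi] at e2
  exact setLIntegral_le_mul_setLIntegral_comp_of_lipschitzWith
    (h.lipschitzWith_turnAngle hk e3.le) isPreconnected_Ico
    (x := x) (y := x - Real.pi / 4) ⟨by linarith, by linarith⟩ ⟨by linarith, by linarith⟩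
    e1.le e2.le hF

/-- The substitution `θ = t - φ` over a full period removes `t` from the turn angle; `t` survives
only as a translation, so the constants do not depend on it. -/
theorem Admissible.exists_mul_setLIntegral_le_polar (h : Admissible a α β τ) :
    ∃ s₁ s₂ c δ ε : ℝ, 0 < s₁ ∧ s₁ < s₂ ∧ 0 < δ ∧ 0 < ε ∧ ∀ G : Direction → ENNReal,
      Measurable G → ∀ t : ℝ,
      ENNReal.ofReal ε * ∫⁻ u in Set.Icc (c - δ) (c + δ), G ((t : Direction) + (u : Direction))
        ≤ ∫⁻ s in Set.Icc s₁ s₂, ∫⁻ φ in Set.Ioo (-Real.pi) Real.pi,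
          G ((t + turnAngle a b α β τ (radialPoint a b α β τ s) (t - φ) : ℝ) : Direction) := by
  obtain ⟨s₁, s₂, c, δ, θ₀, K, hs₁, hs, hδ, hK, hspread⟩ :=
    h.exists_setLIntegral_le_turnAngle (b := b)
  refine ⟨s₁, s₂, c, δ, (s₂ - s₁) / K, hs₁, hs, hδ, div_pos (by linarith) (by exact_mod_cast hK),
    fun G hG t => ?_⟩
  have hF : Measurable fun u : ℝ => G ((t : Direction) + (u : Direction)) :=
    hG.comp (AddCircle.measurable_mk'.const_add _)
  have hper : ∀ s : ℝ, ∫⁻ φ in Set.Ioo (-Real.pi) Real.pi,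
      G ((t + turnAngle a b α β τ (radialPoint a b α β τ s) (t - φ) : ℝ) : Direction)
      = ∫⁻ θ in Set.Ico θ₀ (θ₀ + 2 * Real.pi),
        G ((t : Direction) + (turnAngle a b α β τ (radialPoint a b α β τ s) θ : ℝ)) := by
    intro s
    let H : ℝ → ENNReal := fun θ =>
      G ((t : Direction) + (turnAngle a b α β τ (radialPoint a b α β τ s) θ : ℝ))
    have hH : Function.Periodic H Real.pi := fun θ => by
      simp only [H]
      rw [periodic_turnAngle]
    have hH2 : Function.Periodic (fun φ => H (t - φ)) (2 * Real.pi) := fun φ => by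
      have h1 : Function.Periodic H (2 * Real.pi) := by simpa using hH.nat_mul 2
      simp only
      rw [show t - (φ + 2 * Real.pi) = t - φ - 2 * Real.pi by ring]
      exact h1.sub_eq _
    calc ∫⁻ φ in Set.Ioo (-Real.pi) Real.pi, H (t - φ)
        = ∫⁻ φ in Set.Ioc (-Real.pi) (-Real.pi + 2 * Real.pi), H (t - φ) := by
          rw [show -Real.pi + 2 * Real.pi = Real.pi by ring]
          exact setLIntegral_congr Ioo_ae_eq_Ioc
      _ = ∫⁻ φ in Set.Ioc (t - (θ₀ + 2 * Real.pi)) (t - (θ₀ + 2 * Real.pi) + 2 * Real.pi),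
            H (t - φ) := hH2.setLIntegral_Ioc_eq (by positivity) _ _
      _ = ∫⁻ θ in Set.Ico θ₀ (θ₀ + 2 * Real.pi), H θ := by
          rw [← lintegral_indicator measurableSet_Ioc, ← lintegral_indicator measurableSet_Ico,
            ← lintegral_sub_left_eq_self ((Set.Ico θ₀ (θ₀ + 2 * Real.pi)).indicator H) t]
          refine lintegral_congr fun φ => ?_
          by_cases hφ : t - φ ∈ Set.Ico θ₀ (θ₀ + 2 * Real.pi)
          · rw [Set.indicator_of_mem hφ, Set.indicator_of_mem]
            exact ⟨by linarith [hφ.2], by linarith [hφ.1]⟩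
          · rw [Set.indicator_of_notMem hφ, Set.indicator_of_notMem]
            exact fun h0 => hφ ⟨by linarith [h0.2], by linarith [h0.1]⟩
  simp only [hper]
  have hK' : (K : ENNReal) ≠ 0 := by exact_mod_cast hK.ne'
  calc ENNReal.ofReal ((s₂ - s₁) / K)
        * ∫⁻ u in Set.Icc (c - δ) (c + δ), G ((t : Direction) + (u : Direction))
      = ∫⁻ _ in Set.Icc s₁ s₂, (K : ENNReal)⁻¹
        * ∫⁻ u in Set.Icc (c - δ) (c + δ), G ((t : Direction) + (u : Direction)) := by
        rw [setLIntegral_const, Real.volume_Icc, ENNReal.ofReal_div_of_pos (by exact_mod_cast hK),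
          ENNReal.ofReal_coe_nnreal, div_eq_mul_inv]
        ring
    _ ≤ _ := by
        refine setLIntegral_mono' measurableSet_Icc fun s hs' => ?_
        rw [← ENNReal.div_eq_inv_mul]
        exact ENNReal.div_le_of_le_mul' (hspread s hs' _ hF)

end HopfBEM

/-! ### Transition kernels, measurability and the drift condition. -/

namespace HopfBEM

variable {a b α β τ σ : ℝ}

/-- The transition kernel of the chain `z ↦ step z w` with noise `w` of law `γ`. -/
noncomputable def stepKernel {S : Type*} [MeasurableSpace S] (step : S → E2 → S)
    (hstep : Measurable (Function.uncurry step)) (γ : Measure E2) [IsProbabilityMeasure γ] :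
    Kernel S S where
  toFun z := γ.map (step z)
  measurable' := by
    have h1 : (fun z => γ.map (step z))
        = fun z => (γ.map (Prod.mk z)).map (Function.uncurry step) := by
      funext z
      rw [Measure.map_map hstep measurable_prodMk_left]
      rfl
    rw [h1]
    exact (Measure.measurable_map _ hstep).comp Measurable.map_prodMk_left

section stepKernel

variable {S : Type*} [MeasurableSpace S] {step : S → E2 → S}

theorem measurable_step (hstep : Measurable (Function.uncurry step)) (z : S) :
    Measurable (step z) := hstep.comp measurable_prodMk_left

variable (hstep : Measurable (Function.uncurry step)) (γ : Measure E2) [IsProbabilityMeasure γ]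

theorem stepKernel_apply (z : S) : stepKernel step hstep γ z = γ.map (step z) := rfl

instance : IsMarkovKernel (stepKernel step hstep γ) where
  isProbabilityMeasure z := by
    rw [stepKernel_apply]
    exact Measure.isProbabilityMeasure_map (measurable_step hstep z).aemeasurable

theorem lintegral_stepKernel {f : S → ENNReal} (hf : Measurable f) (z : S) :
    ∫⁻ y, f y ∂stepKernel step hstep γ z = ∫⁻ w, f (step z w) ∂γ := by
  rw [stepKernel_apply, lintegral_map hf (measurable_step hstep z)]

theorem map_prod_eq_bind_stepKernel (ν : Measure S) [SFinite ν] :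
    (ν.prod γ).map (fun p : S × E2 => step p.1 p.2) = ν.bind (stepKernel step hstep γ) := by
  ext A hA
  have hstep' : Measurable fun p : S × E2 => step p.1 p.2 := hstep
  rw [Measure.map_apply hstep' hA, Measure.bind_apply hA (Kernel.aemeasurable _),
    Measure.prod_apply (hstep' hA)]
  refine lintegral_congr fun z => ?_
  rw [stepKernel_apply, Measure.map_apply (measurable_step hstep z) hA]
  rfl

theorem isStationary_iff (ν : Measure S) : IsStationary step γ ν ↔
    IsProbabilityMeasure ν ∧ ν.bind (stepKernel step hstep γ) = ν :=
  and_congr_right fun _ => by rw [map_prod_eq_bind_stepKernel hstep]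

end stepKernel

instance fact_pi_pos : Fact (0 < Real.pi) := ⟨Real.pi_pos⟩

/-- A measurable choice of a representative of a direction. -/
noncomputable def representative (ξ : Direction) : ℝ := (AddCircle.equivIoc Real.pi 0 ξ : ℝ)

theorem coe_representative (ξ : Direction) : ((representative ξ : ℝ) : Direction) = ξ :=
  (AddCircle.equivIoc Real.pi 0).symm_apply_apply ξ

theorem measurable_representative : Measurable representative :=
  measurable_subtype_coe.comp (AddCircle.measurePreserving_equivIoc Real.pi).measurable

attribute [irreducible] representative

/-- The new state when the sum of the position and the noise term is `Z`. -/
noncomputable def pairImage (a b α β τ : ℝ) (Z : E2) (ξ : Direction) : E2 × Direction :=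
  (resolvent a b α β τ Z,
    directionMap (implicitMatrix a b α β τ (resolvent a b α β τ Z))⁻¹ ξ)

theorem Admissible.pairImage_coe (h : Admissible a α β τ) (Z : E2) (t : ℝ) :
    pairImage a b α β τ Z (t : Direction) = (resolvent a b α β τ Z,
      ((t + turnAngle a b α β τ (planeC (resolvent a b α β τ Z)) t : ℝ) : Direction)) := by
  rw [pairImage, h.directionMap_inv_coe]

/-- A measurable representative of the direction reduces the claim to the joint continuity of
`turnAngle` on `ℂ × ℝ`. -/
theorem Admissible.measurable_pairImage (h : Admissible a α β τ) :
    Measurable fun p : E2 × Direction => pairImage a b α β τ p.1 p.2 := by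
  have h1 : (fun p : E2 × Direction => pairImage a b α β τ p.1 p.2)
      = fun p => (resolvent a b α β τ p.1, ((representative p.2
        + turnAngle a b α β τ (planeC (resolvent a b α β τ p.1)) (representative p.2) : ℝ) :
          Direction)) := by
    funext p
    rw [← h.pairImage_coe, coe_representative]
  have hr : Measurable (resolvent a b α β τ) := h.continuous_resolvent.measurable
  have hrep : Measurable fun p : E2 × Direction => representative p.2 :=
    measurable_representative.comp measurable_snd
  have hz : Measurable fun p : E2 × Direction => planeC (resolvent a b α β τ p.1) :=
    planeC.continuous.measurable.comp (hr.comp measurable_fst)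
  have hta : Measurable fun p : ℂ × ℝ => turnAngle a b α β τ p.1 p.2 :=
    h.continuous_turnAngle.measurable
  have ht : Measurable fun p : E2 × Direction =>
      turnAngle a b α β τ (planeC (resolvent a b α β τ p.1)) (representative p.2) := by
    have := hta.comp (hz.prodMk hrep)
    exact this
  have hc : Measurable fun t : ℝ => (t : Direction) := AddCircle.measurable_mk'
  have hfin := (hr.comp measurable_fst).prodMk (hc.comp (hrep.add ht))
  rw [h1]
  exact hfin

theorem Admissible.measurable_bemStep (h : Admissible a α β τ) :
    Measurable (Function.uncurry (bemStep a b α β σ τ)) := by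
  have : Continuous fun p : E2 × E2 => resolvent a b α β τ (p.1 + σ • p.2) :=
    h.continuous_resolvent.comp (by fun_prop)
  exact this.measurable

theorem Admissible.measurable_pairStep (h : Admissible a α β τ) :
    Measurable (Function.uncurry (pairStep a b α β σ τ)) := by
  have h1 : Measurable fun p : (E2 × Direction) × E2 => (p.1.1 + σ • p.2, p.1.2) := by fun_prop
  exact h.measurable_pairImage.comp h1

theorem qHat_eq (z : E2 × Direction) :
    qHat a b α z = qHatReal a b α (z.1 0) (z.1 1) (representative z.2) := by
  rw [qHat]
  nth_rewrite 1 [← coe_representative z.2]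
  exact (periodic_qHatReal a b α (z.1 0) (z.1 1)).lift_coe _

theorem measurable_qHat : Measurable (qHat a b α) := by
  have h1 : qHat a b α = fun z => qHatReal a b α (z.1 0) (z.1 1) (representative z.2) :=
    funext qHat_eq
  have h2 : Measurable fun p : ℝ × ℝ × ℝ => qHatReal a b α p.1 p.2.1 p.2.2 := by
    unfold qHatReal
    fun_prop
  have h3 : Measurable fun z : E2 × Direction => (z.1 0, z.1 1, representative z.2) := by
    have h4 := measurable_representative
    fun_prop
  have h5 := h2.comp h3
  rw [h1]
  exact h5

theorem abs_qHat_le (ha : 0 < a) (hb : 0 < b) (z : E2 × Direction) :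
    |qHat a b α z| ≤ (|α| + 4 * a + 2 * b) * (1 + ‖z.1‖ ^ 2) := by
  rw [qHat_eq, qHatReal, norm_sq_eq]
  generalize z.1 0 = x, z.1 1 = y, representative z.2 = t
  have hc := abs_le.1 (Real.abs_cos_le_one (2 * t))
  have hs := abs_le.1 (Real.abs_sin_le_one (2 * t))
  have h1 : |2 * b * Real.cos (2 * t) + 2 * a * Real.sin (2 * t)| ≤ 2 * b + 2 * a :=
    abs_le.2 ⟨by nlinarith, by nlinarith⟩
  have h2 : |b * Real.sin (2 * t) - a * Real.cos (2 * t)| ≤ b + a :=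
    abs_le.2 ⟨by nlinarith, by nlinarith⟩
  have h3 : |x * y| ≤ (x ^ 2 + y ^ 2) / 2 :=
    abs_le.2 ⟨by nlinarith [sq_nonneg (x + y)], by nlinarith [sq_nonneg (x - y)]⟩
  have h4 : |x ^ 2 - y ^ 2| ≤ x ^ 2 + y ^ 2 :=
    abs_le.2 ⟨by nlinarith [sq_nonneg x], by nlinarith [sq_nonneg y]⟩
  have h5 := mul_le_mul h1 h3 (abs_nonneg _) (by positivity)
  have h6 := mul_le_mul h2 h4 (abs_nonneg _) (by positivity)
  rw [← abs_mul] at h5 h6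
  have h5' := abs_le.1 h5
  have h6' := abs_le.1 h6
  have hα := abs_le.1 (le_refl |α|)
  have hα0 := abs_nonneg α
  have hr : 0 ≤ x ^ 2 + y ^ 2 := by positivity
  have h7 := mul_nonneg hα0 hr
  rw [abs_le]
  constructor <;> nlinarith

theorem integrable_norm_sq_noiseLaw : Integrable (fun w : E2 => ‖w‖ ^ 2) (noiseLaw τ) := by
  rw [noiseLaw, integrable_map_measure (by fun_prop) (WithLp.measurable_toLp 2 _).aemeasurable]
  have h1 : (fun w : E2 => ‖w‖ ^ 2) ∘ (WithLp.toLp 2 : (Fin 2 → ℝ) → E2)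
      = fun v => v 0 ^ 2 + v 1 ^ 2 := by
    funext v
    simp [norm_sq_eq]
  rw [h1]
  have h2 : Integrable (fun x : ℝ => x ^ 2) (gaussianReal 0 τ.toNNReal) :=
    (memLp_id_gaussianReal 2).integrable_sq
  have h3 : ∀ i : Fin 2, Integrable (fun v : Fin 2 → ℝ => v i ^ 2)
      (Measure.pi fun _ : Fin 2 => gaussianReal 0 τ.toNNReal) := fun i =>
    (measurePreserving_eval (fun _ : Fin 2 => gaussianReal 0 τ.toNNReal) i).integrable_comp_of_integrable
      h2
  exact (h3 0).add (h3 1)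

/-- The transition kernel of the pair chain. -/
noncomputable def pairKernel (h : Admissible a α β τ) (b σ : ℝ) :
    Kernel (E2 × Direction) (E2 × Direction) :=
  stepKernel (pairStep a b α β σ τ) h.measurable_pairStep (noiseLaw τ)

instance (h : Admissible a α β τ) : IsMarkovKernel (pairKernel h b σ) := by
  unfold pairKernel
  infer_instance

/-- The bound `‖x + σ w‖² ≤ 2 ‖x‖² + 2 σ² ‖w‖²` meets the factor 1/4 of `norm_sq_resolvent_le`,
leaving 1/2. -/
theorem hasDrift_pairKernel (h : Admissible a α β τ) :
    HasDrift (pairKernel h b σ) (fun z => ‖z.1‖ ^ 2) (1 / 2)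
      (σ ^ 2 / 2 * (∫ w, ‖w‖ ^ 2 ∂noiseLaw τ) + 1 / (τ * a)) := by
  intro z
  have hm : Measurable fun y : E2 × Direction => ‖y.1‖ ^ 2 := by fun_prop
  have hs := measurable_step (h.measurable_pairStep (b := b) (σ := σ)) z
  rw [pairKernel, stepKernel_apply, integrable_map_measure hm.aestronglyMeasurable hs.aemeasurable,
    integral_map hs.aemeasurable hm.aestronglyMeasurable]
  have hle : ∀ w, ‖(pairStep a b α β σ τ z w).1‖ ^ 2
      ≤ σ ^ 2 / 2 * ‖w‖ ^ 2 + (1 / 2 * ‖z.1‖ ^ 2 + 1 / (τ * a)) := by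
    intro w
    have h1 := h.norm_sq_resolvent_le (b := b) (z.1 + σ • w)
    have h2 := norm_add_le z.1 (σ • w)
    rw [norm_smul, Real.norm_eq_abs] at h2
    have h3 : ‖z.1 + σ • w‖ ^ 2 ≤ 2 * ‖z.1‖ ^ 2 + 2 * (σ ^ 2 * ‖w‖ ^ 2) := by
      have h4 := pow_le_pow_left₀ (norm_nonneg _) h2 2
      rw [← sq_abs σ]
      nlinarith [sq_nonneg (‖z.1‖ - |σ| * ‖w‖)]
    refine h1.trans ?_
    linarith
  have hdom : Integrable (fun w => σ ^ 2 / 2 * ‖w‖ ^ 2 + (1 / 2 * ‖z.1‖ ^ 2 + 1 / (τ * a)))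
      (noiseLaw τ) := (integrable_norm_sq_noiseLaw.const_mul _).add (integrable_const _)
  have hint : Integrable (fun w => ‖(pairStep a b α β σ τ z w).1‖ ^ 2) (noiseLaw τ) := by
    refine hdom.mono' (hm.comp hs).aestronglyMeasurable (Filter.Eventually.of_forall fun w => ?_)
    rw [Real.norm_of_nonneg (by positivity)]
    exact hle w
  refine ⟨hint, (integral_mono hint hdom hle).trans (le_of_eq ?_)⟩
  rw [integral_add (integrable_norm_sq_noiseLaw.const_mul _) (integrable_const _),
    integral_const_mul]
  simp
  ring

end HopfBEM

/-! ### Minorization for the pair chain. -/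

namespace HopfBEM

variable {a b α β τ σ : ℝ}

theorem Admissible.norm_radialPoint_le (h : Admissible a α β τ) {s : ℝ} (hs : 0 ≤ s) :
    ‖radialPoint a b α β τ s‖ ≤ 4 / 3 * s := by
  have h1 := h.le_norm_sub_smul_drift (b := b) (resolvent a b α β τ (planeC.symm (s : ℂ)))
  rw [h.resolvent_spec, LinearIsometryEquiv.norm_map, Complex.norm_real,
    Real.norm_of_nonneg hs] at h1
  rw [radialPoint, planeC.norm_map]
  linarith

/-- The transition kernel of the pair dominates a multiple of the image of Lebesgue measure on a
square. -/
theorem exists_mul_setLIntegral_le_lintegral_pairKernel (h : Admissible a α β τ) (hσ : 0 < σ)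
    (R L : ℝ) : ∃ c : ℝ, 0 < c ∧ ∀ z : E2 × Direction, ‖z.1‖ ≤ R →
      ∀ f : E2 × Direction → ENNReal, Measurable f →
        ENNReal.ofReal c * ∫⁻ u in Set.Icc (-L) L, ∫⁻ v in Set.Icc (-L) L,
          f (pairImage a b α β τ !₂[u, v] z.2) ≤ ∫⁻ y, f y ∂pairKernel h b σ z := by
  obtain ⟨c, hc, hle⟩ := exists_mul_setLIntegral_le_lintegral_noiseLaw hσ h.tau_pos R L
  refine ⟨c, hc, fun z hz f hf => ?_⟩
  have hg : Measurable fun Z : E2 => f (pairImage a b α β τ Z z.2) := by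
    have h1 := (h.measurable_pairImage (b := b)).comp
      (measurable_prodMk_right (y := z.2) : Measurable fun Z : E2 => (Z, z.2))
    exact hf.comp h1
  rw [pairKernel, lintegral_stepKernel _ _ hf]
  exact hle z.1 hz _ hg

/-- The resolvent sends the annulus of radii up to `s₂` into the ball of radius `4/3 s₂`. The spread
is therefore produced by paths that stay within radius `R`, and the indicator records this so that
the estimate can be iterated. -/
theorem exists_angle_spread (h : Admissible a α β τ) (b : ℝ) (hσ : 0 < σ) :
    ∃ R₀ c δ : ℝ, 0 < δ ∧ ∀ R, R₀ ≤ R → ∃ ε : ℝ, 0 < ε ∧ ∀ z : E2 × Direction, ‖z.1‖ ≤ R →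
      ∀ G : Direction → ENNReal, Measurable G →
        ENNReal.ofReal ε * ∫⁻ u in Set.Icc (c - δ) (c + δ), G (z.2 + (u : Direction))
          ≤ ∫⁻ y, {y : E2 × Direction | ‖y.1‖ ≤ R}.indicator (fun y => G y.2) y
            ∂pairKernel h b σ z := by
  obtain ⟨s₁, s₂, c, δ, ε, hs₁, hs, hδ, hε, hpol⟩ := h.exists_mul_setLIntegral_le_polar (b := b)
  refine ⟨4 / 3 * s₂, c, δ, hδ, fun R hR => ?_⟩
  obtain ⟨c', hc', hker⟩ := exists_mul_setLIntegral_le_lintegral_pairKernel (b := b) h hσ R s₂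
  refine ⟨c' * (s₁ * ε), by positivity, fun z hz G hG => ?_⟩
  obtain ⟨x, ξ⟩ := z
  obtain ⟨t, rfl⟩ : ∃ t : ℝ, (t : Direction) = ξ := ⟨_, coe_representative ξ⟩
  have hset : MeasurableSet {y : E2 × Direction | ‖y.1‖ ≤ R} :=
    measurableSet_le (by fun_prop) measurable_const
  have hf : Measurable ({y : E2 × Direction | ‖y.1‖ ≤ R}.indicator fun y => G y.2) :=
    (hG.comp measurable_snd).indicator hset
  refine le_trans ?_ (hker _ hz _ hf)
  rw [ENNReal.ofReal_mul hc'.le, mul_assoc]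
  gcongr
  have hg : Measurable fun Z : E2 => {y : E2 × Direction | ‖y.1‖ ≤ R}.indicator (fun y => G y.2)
      (pairImage a b α β τ Z (t : Direction)) := by
    have h1 := (h.measurable_pairImage (b := b)).comp
      (measurable_prodMk_right (y := (t : Direction)) :
        Measurable fun Z : E2 => (Z, (t : Direction)))
    exact hf.comp h1
  refine le_trans ?_ (setLIntegral_polar_le hs₁ le_rfl hg)
  rw [ENNReal.ofReal_mul hs₁.le, mul_assoc]
  gcongr
  refine (hpol G hG t).trans (le_of_eq ?_)
  refine setLIntegral_congr_fun measurableSet_Icc fun s hs' => ?_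
  refine lintegral_congr fun φ => ?_
  have h0 : 0 ≤ s := hs₁.le.trans hs'.1
  rw [h.pairImage_coe, h.planeC_resolvent_polar, turnAngle_mul, Set.indicator_of_mem]
  rw [Set.mem_ofPred_eq, ← planeC.norm_map, h.planeC_resolvent_polar, norm_mul,
    Complex.norm_exp_ofReal_mul_I, one_mul]
  linarith [h.norm_radialPoint_le (b := b) h0, hs'.2]

theorem lintegral_pow_succ {S : Type*} [MeasurableSpace S] (κ : Kernel S S) (n : ℕ) (z : S)
    {f : S → ENNReal} (hf : Measurable f) :
    ∫⁻ y, f y ∂(κ ^ (n + 1)) z = ∫⁻ y, ∫⁻ x, f x ∂(κ ^ n) y ∂κ z := by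
  have h1 : κ ^ (n + 1) = (κ ^ n) ∘ₖ κ := pow_succ κ n
  rw [h1, Kernel.lintegral_comp _ _ _ hf]

theorem lintegral_pow_succ' {S : Type*} [MeasurableSpace S] (κ : Kernel S S) (n : ℕ) (z : S)
    {f : S → ENNReal} (hf : Measurable f) :
    ∫⁻ y, f y ∂(κ ^ (n + 1)) z = ∫⁻ y, ∫⁻ x, f x ∂κ y ∂(κ ^ n) z := by
  have h1 : κ ^ (n + 1) = κ ∘ₖ (κ ^ n) := pow_succ' κ n
  rw [h1, Kernel.lintegral_comp _ _ _ hf]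

/-- By the Markov property, each further step convolves with the interval of half-width `δ`, which
adds `δ / 2` to the half-width already reached. -/
theorem exists_angle_spread_pow (h : Admissible a α β τ) (b : ℝ) (hσ : 0 < σ) :
    ∃ R₀ δ : ℝ, 0 < δ ∧ ∀ R, R₀ ≤ R → ∀ n : ℕ, ∃ c δ' ε : ℝ, δ + n * (δ / 2) ≤ δ' ∧ 0 < ε ∧
      ∀ z : E2 × Direction, ‖z.1‖ ≤ R → ∀ G : Direction → ENNReal, Measurable G →
        ENNReal.ofReal ε * ∫⁻ u in Set.Icc (c - δ') (c + δ'), G (z.2 + (u : Direction))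
          ≤ ∫⁻ y, {y : E2 × Direction | ‖y.1‖ ≤ R}.indicator (fun y => G y.2) y
            ∂(pairKernel h b σ ^ (n + 1)) z := by
  obtain ⟨R₀, c, δ, hδ, hspread⟩ := exists_angle_spread h b hσ
  refine ⟨R₀, δ, hδ, fun R hR n => ?_⟩
  obtain ⟨ε, hε, hR'⟩ := hspread R hR
  have hset : MeasurableSet {y : E2 × Direction | ‖y.1‖ ≤ R} :=
    measurableSet_le (by fun_prop) measurable_const
  induction n with
  | zero =>
    refine ⟨c, δ, ε, by simp, hε, fun z hz G hG => ?_⟩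
    rw [zero_add, pow_one]
    exact hR' z hz G hG
  | succ n ih =>
    obtain ⟨c', δ', ε', hδ', hε', hih⟩ := ih
    refine ⟨c + c', δ' + δ / 2, ε * ε' * (δ / 2), by push_cast; linarith, by positivity,
      fun z hz G hG => ?_⟩
    have hδδ' : δ ≤ δ' := by
      have : 0 ≤ n * (δ / 2) := by positivity
      linarith
    have hadd : Measurable fun p : Direction × ℝ => G (p.1 + (p.2 : Direction)) := by
      have h1 : Measurable fun p : Direction × ℝ => p.1 + (p.2 : Direction) :=
        measurable_fst.add (AddCircle.measurable_mk'.comp measurable_snd)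
      exact hG.comp h1
    have hG' : Measurable fun η : Direction =>
        ENNReal.ofReal ε' * ∫⁻ u in Set.Icc (c' - δ') (c' + δ'), G (η + (u : Direction)) :=
      hadd.lintegral_prod_right'.const_mul _
    have hf : Measurable ({y : E2 × Direction | ‖y.1‖ ≤ R}.indicator fun y => G y.2) :=
      (hG.comp measurable_snd).indicator hset
    have hF : Measurable fun r : ℝ => G (z.2 + (r : Direction)) :=
      hadd.comp measurable_prodMk_left
    rw [lintegral_pow_succ _ _ _ hf]
    calc ENNReal.ofReal (ε * ε' * (δ / 2)) *
          ∫⁻ u in Set.Icc (c + c' - (δ' + δ / 2)) (c + c' + (δ' + δ / 2)),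
            G (z.2 + (u : Direction))
        = ENNReal.ofReal ε * (ENNReal.ofReal ε' * (ENNReal.ofReal (δ / 2) *
          ∫⁻ u in Set.Icc (c + c' - (δ' + δ / 2)) (c + c' + (δ' + δ / 2)),
            G (z.2 + (u : Direction)))) := by
          rw [ENNReal.ofReal_mul (by positivity), ENNReal.ofReal_mul hε.le]
          ring
      _ ≤ ENNReal.ofReal ε * (ENNReal.ofReal ε' * ∫⁻ v in Set.Icc (c - δ) (c + δ),
            ∫⁻ u in Set.Icc (c' - δ') (c' + δ'), G (z.2 + ((v + u : ℝ) : Direction))) := by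
          gcongr
          exact mul_setLIntegral_Icc_le_setLIntegral_setLIntegral_add hF hδ hδδ'
      _ = ENNReal.ofReal ε * ∫⁻ v in Set.Icc (c - δ) (c + δ), ENNReal.ofReal ε' *
            ∫⁻ u in Set.Icc (c' - δ') (c' + δ'), G (z.2 + (v : Direction) + (u : Direction)) := by
          rw [lintegral_const_mul' _ _ ENNReal.ofReal_ne_top]
          simp only [AddCircle.coe_add, add_assoc]
      _ ≤ ∫⁻ y, {y : E2 × Direction | ‖y.1‖ ≤ R}.indicator (fun y => ENNReal.ofReal ε' *
            ∫⁻ u in Set.Icc (c' - δ') (c' + δ'), G (y.2 + (u : Direction))) y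
            ∂pairKernel h b σ z := hR' z hz _ hG'
      _ ≤ _ := by
          refine lintegral_mono fun y => ?_
          by_cases hy : y ∈ {y : E2 × Direction | ‖y.1‖ ≤ R}
          · rw [Set.indicator_of_mem hy]
            exact hih y hy G hG
          · rw [Set.indicator_of_notMem hy]
            exact zero_le

theorem lintegral_direction_le {c δ : ℝ} (hδ : Real.pi / 2 ≤ δ) (ξ : Direction)
    (G : Direction → ENNReal) :
    ∫⁻ η, G η ≤ ∫⁻ u in Set.Icc (c - δ) (c + δ), G (ξ + (u : Direction)) := by
  calc ∫⁻ η, G η = ∫⁻ η, G (ξ + η) := (lintegral_add_left_eq_self G ξ).symm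
    _ = ∫⁻ u in Set.Ioc (c - δ) (c - δ + Real.pi), G (ξ + (u : Direction)) :=
        (AddCircle.lintegral_preimage Real.pi (c - δ) fun η => G (ξ + η)).symm
    _ ≤ ∫⁻ u in Set.Icc (c - δ) (c + δ), G (ξ + (u : Direction)) := by
        refine lintegral_mono_set fun u hu => ?_
        exact ⟨hu.1.le, by linarith [hu.2]⟩

/-- Minorization of an iterate of the pair kernel on bounded sets of positions. -/
theorem exists_minorization_pairKernel (h : Admissible a α β τ) (b : ℝ) (hσ : 0 < σ) (R : ℝ) :
    ∃ N : ℕ, N ≠ 0 ∧ ∃ m : Measure (E2 × Direction), IsProbabilityMeasure m ∧ ∃ c : ℝ, 0 < c ∧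
      c ≤ 1 ∧ ∀ z : E2 × Direction, ‖z.1‖ ^ 2 ≤ R →
        ENNReal.ofReal c • m ≤ (pairKernel h b σ ^ N) z := by
  obtain ⟨R₀, δ, hδ, hspread⟩ := exists_angle_spread_pow h b hσ
  set R' := max R₀ (max R 1) with hR'
  have hR1 : 1 ≤ R' := (le_max_right _ _).trans (le_max_right _ _)
  -- Enough steps for the half-width to reach `π / 2`, so that the interval covers the whole circle
  -- `ℝ / πℤ`.
  obtain ⟨n, hn⟩ := exists_nat_ge (Real.pi / 2 / (δ / 2))
  rw [div_le_iff₀ (by positivity)] at hn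
  obtain ⟨c₁, δ', ε, hδ', hε, hpow⟩ := hspread R' (le_max_left _ _) n
  obtain ⟨c, hc, hker⟩ := exists_mul_setLIntegral_le_lintegral_pairKernel (b := b) h hσ R' 1
  let I : Measure ℝ := volume.restrict (Set.Icc (-1) 1)
  -- The minorizing measure before normalization: a uniform direction moved by one step whose noisy
  -- position is uniform on a square. It does not depend on the starting point.
  let m₀ : Measure (E2 × Direction) := ((volume : Measure Direction).prod (I.prod I)).map
    fun p => pairImage a b α β τ !₂[p.2.1, p.2.2] p.1
  have hmp : Measurable fun p : Direction × (ℝ × ℝ) =>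
      pairImage a b α β τ !₂[p.2.1, p.2.2] p.1 := by
    have h1 : Measurable fun p : Direction × (ℝ × ℝ) => ((!₂[p.2.1, p.2.2] : E2), p.1) := by
      have h2 : Measurable fun p : Direction × (ℝ × ℝ) => (!₂[p.2.1, p.2.2] : E2) := by
        have h3 : Measurable fun p : Direction × (ℝ × ℝ) => p.2 := measurable_snd
        have h4 := measurable_toE2.comp h3
        exact h4
      exact h2.prodMk measurable_fst
    have h3 := (h.measurable_pairImage (b := b)).comp h1
    exact h3
  have hm₀univ : m₀ Set.univ = ENNReal.ofReal (4 * Real.pi) := by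
    rw [Measure.map_apply hmp MeasurableSet.univ, Set.preimage_univ, ← Set.univ_prod_univ,
      Measure.prod_prod, ← Set.univ_prod_univ, Measure.prod_prod, AddCircle.measure_univ]
    simp only [I, Measure.restrict_apply_univ, Real.volume_Icc]
    rw [← ENNReal.ofReal_mul (by norm_num), ← ENNReal.ofReal_mul Real.pi_pos.le]
    congr 1
    ring
  have hπ := Real.pi_pos
  have hle : ∀ z : E2 × Direction, ‖z.1‖ ^ 2 ≤ R →
      -- The first `n + 1` steps spread the direction and keep the position bounded; the last one
      -- spreads the position.
      ENNReal.ofReal (ε * c) • m₀ ≤ (pairKernel h b σ ^ (n + 1 + 1)) z := by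
    intro z hz
    have hz' : ‖z.1‖ ≤ R' := by
      have h1 : R ≤ R' := (le_max_left _ _).trans (le_max_right _ _)
      by_contra hlt
      have := not_le.1 hlt
      nlinarith
    refine Measure.le_iff.2 fun A hA => ?_
    have hf : Measurable (A.indicator fun _ => (1 : ENNReal)) := measurable_const.indicator hA
    have hfi : ∀ μ : Measure (E2 × Direction), ∫⁻ y, A.indicator (fun _ => (1 : ENNReal)) y ∂μ
        = μ A := fun μ => lintegral_indicator_one hA
    have hG3 : Measurable fun p : Direction × (ℝ × ℝ) => A.indicator (fun _ => (1 : ENNReal))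
        (pairImage a b α β τ !₂[p.2.1, p.2.2] p.1) := hf.comp hmp
    let G : Direction → ENNReal := fun η => ∫⁻ u in Set.Icc (-1) 1, ∫⁻ v in Set.Icc (-1) 1,
      A.indicator (fun _ => (1 : ENNReal)) (pairImage a b α β τ !₂[u, v] η)
    have hGeq : G = fun η => ∫⁻ q, A.indicator (fun _ => (1 : ENNReal))
        (pairImage a b α β τ !₂[q.1, q.2] η) ∂(I.prod I) := by
      funext η
      exact (lintegral_prod _ (hG3.comp measurable_prodMk_left).aemeasurable).symm
    have hG : Measurable G := by
      rw [hGeq]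
      exact hG3.lintegral_prod_right'
    have hm₀A : m₀ A = ∫⁻ η, G η := by
      rw [← hfi m₀, lintegral_map hf hmp, lintegral_prod _ hG3.aemeasurable, hGeq]
    rw [Measure.smul_apply, smul_eq_mul, hm₀A, ← hfi, lintegral_pow_succ' _ _ _ hf,
      ENNReal.ofReal_mul hε.le, mul_assoc]
    calc ENNReal.ofReal ε * (ENNReal.ofReal c * ∫⁻ η, G η)
        = ENNReal.ofReal ε * ∫⁻ η, ENNReal.ofReal c * G η := by
          rw [lintegral_const_mul _ hG]
      _ ≤ ENNReal.ofReal ε * ∫⁻ u in Set.Icc (c₁ - δ') (c₁ + δ'),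
            ENNReal.ofReal c * G (z.2 + (u : Direction)) := by
          gcongr
          exact lintegral_direction_le (by linarith) z.2 _
      _ ≤ ∫⁻ y, {y : E2 × Direction | ‖y.1‖ ≤ R'}.indicator
            (fun y => ENNReal.ofReal c * G y.2) y ∂(pairKernel h b σ ^ (n + 1)) z :=
          hpow z hz' _ (hG.const_mul _)
      _ ≤ _ := by
          refine lintegral_mono fun y => ?_
          by_cases hy : y ∈ {y : E2 × Direction | ‖y.1‖ ≤ R'}
          · rw [Set.indicator_of_mem hy]
            exact hker y hy _ hf
          · rw [Set.indicator_of_notMem hy]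
            exact zero_le
  have hM0 : ENNReal.ofReal (4 * Real.pi) ≠ 0 := by simpa using hπ
  refine ⟨n + 1 + 1, by omega, (ENNReal.ofReal (4 * Real.pi))⁻¹ • m₀, ⟨?_⟩,
    min 1 (ε * c * (4 * Real.pi)), lt_min one_pos (by positivity), min_le_left _ _,
    fun z hz => le_trans ?_ (hle z hz)⟩
  · rw [Measure.smul_apply, hm₀univ, smul_eq_mul, ENNReal.inv_mul_cancel hM0 ENNReal.ofReal_ne_top]
  · rw [smul_smul]
    refine Measure.le_iff.2 fun A _ => ?_
    rw [Measure.smul_apply, Measure.smul_apply, smul_eq_mul, smul_eq_mul]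
    gcongr
    rw [← div_eq_mul_inv, ENNReal.div_le_iff hM0 ENNReal.ofReal_ne_top,
      ← ENNReal.ofReal_mul (by positivity)]
    exact ENNReal.ofReal_le_ofReal (min_le_right _ _)

end HopfBEM

/-! ### From Brownian motion to the chain, and projection to the position. -/

namespace HopfBEM

variable {a b α β τ σ : ℝ}

section Noise

variable {Ω : Type*} [MeasurableSpace Ω] {P : Measure Ω}

/-- A sequence of noise vectors of law `γ`, each independent of the preceding ones. -/
structure IsNoise (D : ℕ → Ω → E2) (γ : Measure E2) (P : Measure Ω) : Prop where
  hasLaw : ∀ n, HasLaw (D n) γ P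
  indepFun : ∀ n, IndepFun (fun ω (k : Finset.range n) => D k ω) (D n) P

/-- The state at time `n` of the chain `z ↦ step z w` started at `z` and driven by the noise
sequence `v`. -/
def iterState {S : Type*} (step : S → E2 → S) (z : S) : ℕ → (ℕ → E2) → S
  | 0, _ => z
  | n + 1, v => step (iterState step z n v) (v n)

theorem iterState_congr {S : Type*} (step : S → E2 → S) (z : S) {n : ℕ} {v v' : ℕ → E2}
    (h : ∀ k < n, v k = v' k) : iterState step z n v = iterState step z n v' := by
  induction n with
  | zero => rfl
  | succ n ih => rw [iterState, iterState, ih fun k hk => h k (by omega), h n (by omega)]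

theorem measurable_iterState {S : Type*} [MeasurableSpace S] {step : S → E2 → S}
    (hstep : Measurable (Function.uncurry step)) (z : S) (n : ℕ) :
    Measurable (iterState step z n) := by
  induction n with
  | zero => exact measurable_const
  | succ n ih => exact hstep.comp (ih.prodMk (measurable_pi_apply n))

theorem IsNoise.indepFun_iterState {D : ℕ → Ω → E2} {γ : Measure E2} (hD : IsNoise D γ P)
    {S : Type*} [MeasurableSpace S] {step : S → E2 → S}
    (hstep : Measurable (Function.uncurry step)) (z : S) (n : ℕ) :
    IndepFun (fun ω => iterState step z n fun k => D k ω) (D n) P := by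
  -- The state at time `n` reads only the noise before `n`, so extending the finite block by 0
  -- leaves it unchanged and exhibits it as a function of that block.
  have hext : Measurable fun (u : Finset.range n → E2) (k : ℕ) =>
      if hk : k ∈ Finset.range n then u ⟨k, hk⟩ else 0 := by
    refine measurable_pi_lambda _ fun k => ?_
    by_cases hk : k ∈ Finset.range n
    · simpa only [hk, dite_true] using measurable_pi_apply _
    · simpa only [hk, dite_false] using measurable_const
  have h1 := (hD.indepFun n).comp ((measurable_iterState hstep z n).comp hext) measurable_id
  rw [Function.id_comp] at h1
  convert h1 using 1
  funext ω
  refine iterState_congr step z fun k hk => ?_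
  simp only [Finset.mem_range, hk, dite_true]

theorem IsNoise.aemeasurable_iterState {D : ℕ → Ω → E2} {γ : Measure E2} (hD : IsNoise D γ P)
    {S : Type*} [MeasurableSpace S] {step : S → E2 → S}
    (hstep : Measurable (Function.uncurry step)) (z : S) (n : ℕ) :
    AEMeasurable (fun ω => iterState step z n fun k => D k ω) P :=
  (measurable_iterState hstep z n).comp_aemeasurable
    (aemeasurable_pi_iff.2 fun k => (hD.hasLaw k).aemeasurable)

theorem IsNoise.map_iterState [IsProbabilityMeasure P] {D : ℕ → Ω → E2} {γ : Measure E2}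
    [IsProbabilityMeasure γ] (hD : IsNoise D γ P) {S : Type*} [MeasurableSpace S]
    {step : S → E2 → S} (hstep : Measurable (Function.uncurry step)) (z : S) (n : ℕ) :
    P.map (fun ω => iterState step z n fun k => D k ω) = (stepKernel step hstep γ ^ n) z := by
  induction n with
  | zero =>
    have h1 : stepKernel step hstep γ ^ 0 = Kernel.id := rfl
    rw [h1, Kernel.id_apply]
    simp [iterState]
  | succ n ih =>
    have hZ := hD.aemeasurable_iterState hstep z n
    have h1 := (hD.indepFun_iterState hstep z n).map_prod_eq_prod_map_map hZ
      (hD.hasLaw n).aemeasurable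
    have h2 : stepKernel step hstep γ ^ (n + 1)
      = stepKernel step hstep γ ∘ₖ (stepKernel step hstep γ ^ n) :=
      pow_succ' (stepKernel step hstep γ) n
    have h3 : P.map (fun ω => iterState step z (n + 1) fun k => D k ω)
        = (P.map fun ω => (iterState step z n (fun k => D k ω), D n ω)).map
          (fun p : S × E2 => step p.1 p.2) :=
      (AEMeasurable.map_map_of_aemeasurable (Measurable.aemeasurable hstep)
        (hZ.prodMk (hD.hasLaw n).aemeasurable)).symm
    have : IsProbabilityMeasure (P.map fun ω => iterState step z n fun k => D k ω) :=
      Measure.isProbabilityMeasure_map hZ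
    rw [h3, h1, (hD.hasLaw n).map_eq, map_prod_eq_bind_stepKernel hstep, ih, h2, Kernel.comp_apply]

end Noise

section Increments

variable {Ω : Type*} [MeasurableSpace Ω] {P : Measure Ω} {W : Fin 2 → ℝ≥0 → Ω → ℝ}

/-- A variant of `iIndepFun_uncurry'` for almost everywhere measurable functions. -/
theorem iIndepFun_uncurry_of_aemeasurable {ι κ : Type*} [Countable κ] {d : ι → κ → Ω → ℝ}
    (hdm : ∀ i k, AEMeasurable (d i k) P) (h1 : iIndepFun (fun i ω k => d i k ω) P)
    (h2 : ∀ i, iIndepFun (d i) P) : iIndepFun (fun (p : ι × κ) ω => d p.1 p.2 ω) P := by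
  have h4 := iIndepFun_uncurry' (X := fun i k => (hdm i k).mk (d i k)) (P := P)
    (fun i k => (hdm i k).measurable_mk)
    (h1.congr fun i => (ae_all_iff.2 fun k => (hdm i k).ae_eq_mk).mono fun ω hω => funext hω)
    (fun i => (h2 i).congr fun k => (hdm i k).ae_eq_mk)
  exact h4.congr fun p => (hdm p.1 p.2).ae_eq_mk.symm

/-- Independence of the two coordinates as paths combines with independence in time within each
coordinate. -/
theorem IsPlanarBrownian.iIndepFun_increment (hW : IsPlanarBrownian W P) (hτ : 0 < τ) :
    iIndepFun (fun (p : Fin 2 × ℕ) ω => increment W τ p.2 ω p.1) P := by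
  refine iIndepFun_uncurry_of_aemeasurable (d := fun i k ω => increment W τ k ω i)
    (fun i k => ?_) ?_ fun i => ?_
  · exact ((hW.1 i).aemeasurable _).sub ((hW.1 i).aemeasurable _)
  · have hg : ∀ _ : Fin 2, Measurable fun (f : ℝ≥0 → ℝ) (k : ℕ) =>
        f (((k : ℝ) + 1) * τ).toNNReal - f ((k : ℝ) * τ).toNNReal := fun _ => by fun_prop
    have h1 := hW.2.comp _ hg
    exact h1
  · have hmono : Monotone fun k : ℕ => ((k : ℝ) * τ).toNNReal := fun m n hmn =>
      Real.toNNReal_le_toNNReal (by gcongr)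
    have h1 := (hW.1 i).hasIndepIncrements.nat hmono
    refine h1.congr fun k => Filter.Eventually.of_forall fun ω => ?_
    simp only [increment, Nat.cast_succ]

theorem IsPlanarBrownian.hasLaw_increment_apply (hW : IsPlanarBrownian W P) (hτ : 0 < τ)
    (i : Fin 2) (k : ℕ) :
    HasLaw (fun ω => increment W τ k ω i) (gaussianReal 0 τ.toNNReal) P := by
  have h1 := (hW.1 i).hasLaw_sub (((k : ℝ) + 1) * τ).toNNReal ((k : ℝ) * τ).toNNReal
  have h2 : nndist (((k : ℝ) + 1) * τ).toNNReal.1 ((k : ℝ) * τ).toNNReal.1 = τ.toNNReal := by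
    have h3 : (((k : ℝ) + 1) * τ).toNNReal.1 = ((k : ℝ) + 1) * τ :=
      Real.coe_toNNReal _ (by positivity)
    have h4 : ((k : ℝ) * τ).toNNReal.1 = (k : ℝ) * τ := Real.coe_toNNReal _ (by positivity)
    rw [h3, h4]
    ext
    rw [coe_nndist, Real.dist_eq, Real.coe_toNNReal _ hτ.le,
      show ((k : ℝ) + 1) * τ - k * τ = τ by ring, abs_of_pos hτ]
  rw [h2] at h1
  exact h1

theorem IsPlanarBrownian.isNoise_increment (hW : IsPlanarBrownian W P) (hτ : 0 < τ) :
    IsNoise (increment W τ) (noiseLaw τ) P := by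
  have hind := hW.iIndepFun_increment hτ
  have hlaw := fun i k => hW.hasLaw_increment_apply hτ i k
  have hm : ∀ p : Fin 2 × ℕ, AEMeasurable (fun ω => increment W τ p.2 ω p.1) P := fun p =>
    (hlaw p.1 p.2).aemeasurable
  refine ⟨fun n => ?_, fun n => ?_⟩
  · have h1 : iIndepFun (fun i ω => increment W τ n ω i) P :=
      hind.precomp (g := fun i => (i, n)) fun i j hij => congrArg Prod.fst hij
    have h2 := h1.map_fun_eq_pi_map fun i => hm (i, n)
    have h3 : AEMeasurable (fun ω i => increment W τ n ω i) P :=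
      aemeasurable_pi_iff.2 fun i => hm (i, n)
    refine ⟨(WithLp.measurable_toLp 2 _).comp_aemeasurable h3, ?_⟩
    rw [noiseLaw]
    simp_rw [fun i => (hlaw i n).map_eq] at h2
    rw [← h2, AEMeasurable.map_map_of_aemeasurable
      (WithLp.measurable_toLp 2 _).aemeasurable h3]
    rfl
  · have h1 := hind.indepFun_finset₀ (Finset.univ ×ˢ Finset.range n) (Finset.univ ×ˢ {n})
      (Finset.disjoint_left.2 fun p hp hp' => by
        simp only [Finset.mem_product, Finset.mem_range, Finset.mem_singleton] at hp hp'
        omega) hm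
    refine h1.comp (φ := fun u (k : Finset.range n) =>
        (WithLp.toLp 2 fun i => u ⟨(i, k), by simp⟩ : E2))
      (ψ := fun u => (WithLp.toLp 2 fun i => u ⟨(i, n), by simp⟩ : E2)) ?_ ?_
    · refine measurable_pi_lambda _ fun k => (WithLp.measurable_toLp 2 _).comp ?_
      fun_prop
    · refine (WithLp.measurable_toLp 2 _).comp ?_
      fun_prop

end Increments

section Solution

variable {Ω : Type*} [MeasurableSpace Ω] {P : Measure Ω} {W : Fin 2 → ℝ≥0 → Ω → ℝ}

/-- The implicit matrix maps `U (k + 1)` back to `U k`, so a vanishing vector would force `u₀ = 0`.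
All directions are thus genuine, and the inverse matrix moves them forward. -/
theorem IsBEMSolution.ae_eq_iterState (h : Admissible a α β τ) {x₀ u₀ : E2} {X U : ℕ → Ω → E2}
    (hXU : IsBEMSolution a b α β σ τ W P x₀ u₀ X U) (hu₀ : u₀ ≠ 0) :
    ∀ᵐ ω ∂P, ∀ k, (X k ω, lineAngle (U k ω))
      = iterState (pairStep a b α β σ τ) (x₀, lineAngle u₀) k fun j => increment W τ j ω := by
  filter_upwards [hXU] with ω ⟨hX0, hU0, hstep⟩ k
  have hU : ∀ k, (implicitMatrix a b α β τ (X (k + 1) ω)).toEuclideanLin (U (k + 1) ω)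
      = U k ω := fun k => by
    rw [implicitMatrix_apply, sub_eq_iff_eq_add]
    exact (hstep k).2
  have hU' : ∀ k, ((implicitMatrix a b α β τ (X (k + 1) ω))⁻¹).toEuclideanLin (U k ω)
      = U (k + 1) ω := fun k => by
    rw [← hU k, inv_implicitMatrix_apply_self h]
  have hne : ∀ k, U k ω ≠ 0 := fun k => by
    induction k with
    | zero => rwa [hU0]
    | succ k ih =>
      intro h0
      apply ih
      rw [← hU k, h0, map_zero]
  induction k with
  | zero => rw [iterState, hX0, hU0]
  | succ k ih =>
    have hX : bemStep a b α β σ τ (X k ω) (increment W τ k ω) = X (k + 1) ω := by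
      rw [h.bemStep_eq_iff, sub_eq_iff_eq_add, add_right_comm]
      exact (hstep k).1
    rw [iterState, ← ih, pairStep, hX, directionMap_lineAngle _ (hne k), hU' k]

/-- The law of the scheme and of the direction of its linearization. -/
theorem IsBEMSolution.hasLaw (h : Admissible a α β τ) (hW : IsPlanarBrownian W P) {x₀ u₀ : E2}
    {X U : ℕ → Ω → E2} (hXU : IsBEMSolution a b α β σ τ W P x₀ u₀ X U) (hu₀ : u₀ ≠ 0) (k : ℕ) :
    HasLaw (fun ω => (X k ω, lineAngle (U k ω)))
      ((pairKernel h b σ ^ k) (x₀, lineAngle u₀)) P := by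
  have : IsProbabilityMeasure P := hW.2.isProbabilityMeasure
  have hD := hW.isNoise_increment h.tau_pos
  have hs := h.measurable_pairStep (b := b) (σ := σ)
  have h1 : (fun ω => (X k ω, lineAngle (U k ω))) =ᵐ[P] fun ω =>
      iterState (pairStep a b α β σ τ) (x₀, lineAngle u₀) k fun j => increment W τ j ω :=
    (hXU.ae_eq_iterState h hu₀).mono fun ω hω => hω k
  exact ⟨(hD.aemeasurable_iterState hs _ k).congr h1.symm,
    (Measure.map_congr h1).trans (hD.map_iterState hs _ k)⟩

end Solution

section Position

/-- The position of the pair chain is a Markov chain. -/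
theorem map_fst_pairKernel_pow (h : Admissible a α β τ) (n : ℕ) (z : E2 × Direction) :
    ((pairKernel h b σ ^ n) z).map Prod.fst
      = (stepKernel (bemStep a b α β σ τ) h.measurable_bemStep (noiseLaw τ) ^ n) z.1 := by
  induction n generalizing z with
  | zero =>
    have h1 : pairKernel h b σ ^ 0 = Kernel.id := rfl
    have h2 : stepKernel (bemStep a b α β σ τ) h.measurable_bemStep (noiseLaw τ) ^ 0
      = Kernel.id := rfl
    rw [h1, h2, Kernel.id_apply, Kernel.id_apply, Measure.map_dirac' measurable_fst]
  | succ n ih =>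
    ext A hA
    have hA' : MeasurableSet (Prod.fst ⁻¹' A : Set (E2 × Direction)) := measurable_fst hA
    rw [Measure.map_apply measurable_fst hA, ← lintegral_indicator_one hA',
      ← lintegral_indicator_one hA, lintegral_pow_succ _ _ _ (measurable_one.indicator hA'),
      lintegral_pow_succ _ _ _ (measurable_one.indicator hA)]
    simp only [lintegral_indicator_one hA', lintegral_indicator_one hA]
    rw [lintegral_stepKernel _ _ (Kernel.measurable_coe _ hA)]
    refine (lintegral_stepKernel h.measurable_pairStep _ (Kernel.measurable_coe _ hA') z).trans ?_
    refine lintegral_congr fun w => ?_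
    rw [← Measure.map_apply measurable_fst hA, ih]
    rfl

theorem map_fst_bind_pairKernel (h : Admissible a α β τ) (ν : Measure (E2 × Direction)) :
    (ν.map Prod.fst).bind (stepKernel (bemStep a b α β σ τ) h.measurable_bemStep (noiseLaw τ))
      = (ν.bind (pairKernel h b σ)).map Prod.fst := by
  ext A hA
  have hA' : MeasurableSet (Prod.fst ⁻¹' A : Set (E2 × Direction)) := measurable_fst hA
  rw [Measure.map_apply measurable_fst hA, Measure.bind_apply hA (Kernel.aemeasurable _),
    Measure.bind_apply hA' (Kernel.aemeasurable _),
    lintegral_map (Kernel.measurable_coe _ hA) measurable_fst]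
  refine lintegral_congr fun z => ?_
  rw [← Measure.map_apply measurable_fst hA]
  have h1 := map_fst_pairKernel_pow (b := b) (σ := σ) h 1 z
  rw [pow_one, pow_one] at h1
  rw [h1]

end Position

end HopfBEM

/-! ### Assembly of the result. -/

theorem proposition3p4 (a b α β σ τ M : ℝ) (ha : 0 < a) (hσ : 0 < σ) (hb : 4 * a < b)
    (hM : 1 ≤ M) (hτ : 0 < τ)
    (hτ_lt : τ < min (min (a / (1 + 4 * b * |β|)) (1 / (1 + 12 * |β|)))
      (min (1 / (1 + 4 * |α|)) (4 / a))) :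
    -- both implicit equations of the scheme are uniquely solvable
    (Function.Bijective fun Y : E2 => Y - τ • drift a b α β Y) ∧
    (∀ Y : E2, IsUnit (implicitMatrix a b α β τ Y).det) ∧
    -- unique stationary measure of the position chain
    (∃! νX : Measure E2, IsStationary (bemStep a b α β σ τ) (noiseLaw τ) νX) ∧
    -- unique stationary measure of the pair chain, and geometric convergence
    ∃ ν : Measure (E2 × Direction),
      (IsStationary (pairStep a b α β σ τ) (noiseLaw τ) ν ∧
        ∀ ν' : Measure (E2 × Direction),
          IsStationary (pairStep a b α β σ τ) (noiseLaw τ) ν' → ν' = ν) ∧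
      Integrable (qHat a b α) ν ∧
      ∃ ι ∈ Set.Ioo (0 : ℝ) 1, ∃ κ : ℝ, 0 < κ ∧
        ∀ (Ω : Type*) [MeasurableSpace Ω] (P : Measure Ω) (W : Fin 2 → ℝ≥0 → Ω → ℝ)
          (x₀ u₀ : E2) (X U : ℕ → Ω → E2),
          IsPlanarBrownian W P → u₀ ≠ 0 → IsBEMSolution a b α β σ τ W P x₀ u₀ X U →
          ∀ k : ℕ,
            Integrable (fun ω => qHat a b α (X k ω, lineAngle (U k ω))) P ∧
            |∫ ω, qHat a b α (X k ω, lineAngle (U k ω)) ∂P - ∫ z, qHat a b α z ∂ν|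
              ≤ κ * ι ^ ((k : ℝ) * τ) * gammaBar M x₀ (lineAngle u₀) := by
  have h : Admissible a α β τ := Admissible.of_lt ha hτ hτ_lt
  have hb0 : 0 < b := by linarith
  have hVm : Measurable fun z : E2 × Direction => ‖z.1‖ ^ 2 := by fun_prop
  have hV : ∀ z : E2 × Direction, 0 ≤ ‖z.1‖ ^ 2 := fun z => sq_nonneg _
  have hdrift := hasDrift_pairKernel (b := b) (σ := σ) h
  have hK : 0 ≤ σ ^ 2 / 2 * (∫ w, ‖w‖ ^ 2 ∂noiseLaw τ) + 1 / (τ * a) := by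
    have : 0 ≤ ∫ w, ‖w‖ ^ 2 ∂noiseLaw τ := integral_nonneg fun w => sq_nonneg _
    positivity
  obtain ⟨ν, hν, hinv, hVν, C, ρ, hC, hρ, hρ1, hconv⟩ :=
    exists_invariant_geometric (pairKernel h b σ) hdrift hVm hV (by norm_num) (by norm_num) hK
      (exists_minorization_pairKernel h b hσ)
  have hpow : ∀ n : ℕ, IsMarkovKernel (pairKernel h b σ ^ n) := fun n =>
    (hdrift.pow hVm hV (by norm_num) (by norm_num) hK n).1
  have htend : ∀ A, MeasurableSet A → ∀ z, Filter.Tendsto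
      (fun n : ℕ => ((pairKernel h b σ ^ n) z).real A) Filter.atTop (nhds (ν.real A)) := by
    intro A hA z
    have h1 : ∀ n : ℕ, |((pairKernel h b σ ^ n) z).real A - ν.real A|
        ≤ C * ρ ^ n * 1 * (1 + ‖z.1‖ ^ 2) := fun n => by
      have h2 := (hconv (A.indicator 1) 1 (measurable_one.indicator hA) (fun x => ?_) n z).2
      · rwa [integral_indicator_one hA, integral_indicator_one hA] at h2
      · have := hV x
        by_cases hx : x ∈ A
        · simp [hx]
        · simp only [hx, not_false_eq_true, Set.indicator_of_notMem, abs_zero]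
          linarith
    have h3 : Filter.Tendsto (fun n : ℕ => C * ρ ^ n * 1 * (1 + ‖z.1‖ ^ 2)) Filter.atTop
        (nhds 0) := by
      simpa using (((tendsto_pow_atTop_nhds_zero_of_lt_one hρ.le hρ1).const_mul C).mul_const
        1).mul_const (1 + ‖z.1‖ ^ 2)
    exact tendsto_iff_norm_sub_tendsto_zero.2
      (squeeze_zero (fun n => norm_nonneg _) (fun n => h1 n) h3)
  have hq : ∀ z, |qHat a b α z| ≤ (|α| + 4 * a + 2 * b) * (1 + ‖z.1‖ ^ 2) := abs_qHat_le ha hb0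
  -- The rate is measured in physical time: `ι = ρ ^ (1 / τ)` gives `ι ^ (k τ) = ρ ^ k`.
  refine ⟨h.bijective, h.isUnit_det, ⟨ν.map Prod.fst, ?_, ?_⟩, ν, ⟨?_, ?_⟩, ?_, ρ ^ (1 / τ),
    ⟨Real.rpow_pos_of_pos hρ _, Real.rpow_lt_one hρ.le hρ1 (by positivity)⟩,
    C * (|α| + 4 * a + 2 * b), by positivity, ?_⟩
  · refine (isStationary_iff h.measurable_bemStep _ _).2
      ⟨Measure.isProbabilityMeasure_map measurable_fst.aemeasurable, ?_⟩
    rw [map_fst_bind_pairKernel h, hinv]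
  · intro μ hμ
    obtain ⟨hμ1, hμ2⟩ := (isStationary_iff h.measurable_bemStep _ _).1 hμ
    have hνX : IsProbabilityMeasure (ν.map Prod.fst) :=
      Measure.isProbabilityMeasure_map measurable_fst.aemeasurable
    refine eq_of_bind_eq_of_tendsto hμ2 (fun A hA x => ?_) fun n => ⟨fun x => ?_⟩
    -- The initial direction 0 is arbitrary, since the law of the position does not depend on it.
    · have h1 := htend _ (measurable_fst hA) (x, 0)
      have h2 : ∀ μ' : Measure (E2 × Direction), μ'.real (Prod.fst ⁻¹' A)
          = (μ'.map Prod.fst).real A := fun μ' =>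
        (map_measureReal_apply measurable_fst hA).symm
      simp_rw [h2, map_fst_pairKernel_pow h] at h1
      exact h1
    · rw [← map_fst_pairKernel_pow h n (x, 0)]
      have := hpow n
      exact Measure.isProbabilityMeasure_map measurable_fst.aemeasurable
  · exact (isStationary_iff h.measurable_pairStep _ _).2 ⟨hν, hinv⟩
  · intro ν' hν'
    obtain ⟨hν1, hν2⟩ := (isStationary_iff h.measurable_pairStep _ _).1 hν'
    exact eq_of_bind_eq_of_tendsto (κ := pairKernel h b σ) hν2 htend hpow
  · exact integrable_of_abs_le_affine hVν measurable_qHat fun z =>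
      (hq z).trans (le_of_eq (mul_one_add _ _))
  · intro Ω _ P W x₀ u₀ X U hW hu₀ hXU k
    have hlaw := hXU.hasLaw h hW hu₀ k
    obtain ⟨h1, h2⟩ := hconv _ _ measurable_qHat hq k (x₀, lineAngle u₀)
    rw [← hlaw.map_eq] at h1 h2
    rw [integral_map hlaw.aemeasurable measurable_qHat.aestronglyMeasurable] at h2
    refine ⟨(integrable_map_measure measurable_qHat.aestronglyMeasurable
      hlaw.aemeasurable).1 h1, h2.trans ?_⟩
    have h3 : (ρ ^ (1 / τ)) ^ ((k : ℝ) * τ) = ρ ^ k := by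
      rw [← Real.rpow_mul hρ.le, one_div, mul_left_comm, inv_mul_cancel₀ hτ.ne', mul_one,
        Real.rpow_natCast]
    -- Here `1 ≤ M` lets `gammaBar` absorb the weight `1 + V`.
    have h4 : 1 + ‖x₀‖ ^ 2 ≤ gammaBar M x₀ (lineAngle u₀) := by
      have := sq_nonneg ‖lineAngle u₀‖
      rw [gammaBar]
      linarith
    rw [h3, mul_right_comm C]
    gcongr
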